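/- Let $n\ge 2$, let $J_0$ be the standard complex structure on $\mathbb{C}^n$, and write $\mathbf{z}=\sum_{i=1}^n|z_i|^2$. For $0\le\alpha<\beta\le\infty$ let $\mathcal{A}_{\alpha,\beta}=\{z\in\mathbb{C}^n:\alpha<\mathbf{z}<\beta\}$. For a metric $g$ that is Hermitian with respect to $J_0$, let $\omega=g(J_0\cdot,\cdot)$ be its associated $2$-form (so $g$ is Kähler iff $d\omega=0$), let $S$ be the scalar curvature of its Levi-Civita connection, and let $S_C=g^{i\bar j}g^{k\bar\ell}\Theta_{i\bar jk\bar\ell}$ be its Chern scalar curvature, where $g_{i\bar j}=g(\partial/\partial z_i,\partial/\partial\bar z_j)$ and $\Theta$ is the curvature of the Chern connection. Let $g$ be a $\mathrm{U}(n)$-invariant Kähler metric on $\mathcal{A}_{\alpha,\beta}$ with smooth Kähler potential $\phi(\mathbf{z})$, i.e. $\omega=\sqrt{-1}\,\partial\bar\partial\phi(\mathbf{z})$. Let $H$ denote any antiderivative of $\dfrac{1}{\mathbf{z}^n(\phi')^{n-1}}$ on $(\alpha,\beta)$ and put $$v=H(\mathbf{z})^{\frac{1}{2n-1}}\quad(\text{real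 odd root; so } v^2=|H(\mathbf{z})|^{\frac{2}{2n-1}}).$$ 1. Such $H$ exist, each of them has at most one zero in $(\alpha,\beta)$, and if $\beta<\infty$ the constant of integration can be chosen so that $H$ has no zero in $(\alpha,\beta)$. 2. For every $H$ and all $\alpha\le\alpha'<\beta'\le\beta$ such that $H$ has no zero in $(\alpha',\beta')$, the metric $v^2g$ is a non-Kähler Hermitian metric on $(\mathcal{A}_{\alpha',\beta'},J_0)$ that satisfies $S=2S_C$. 3. Up to scale and the constant of integration, this is the unique $\mathrm{U}(n)$-invariant conformal factor with this property: for a smooth positive $\mathrm{U}(n)$-invariant function $\kappa$ on $\mathcal{A}_{\alpha,\beta}$, the metric $\kappa g$ is a non-Kähler Hermitian metric on $\mathcal{A}_{\alpha,\beta}$ with $S=2S_C$ if and only if $\kappa=c\,v^2$ for some constant $c>0$ and some $H$ as above without zeros in $(\alpha,\beta)$. -/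

import Mathlib

open scoped ContDiff

noncomputable section

namespace HermitianKlsc

/-- The space `ℂⁿ`. -/
abbrev Cn (n : ℕ) : Type := EuclideanSpace ℂ (Fin n)

/-- A field of real bilinear forms on `ℂⁿ` (its real tangent spaces are all `ℂⁿ`). -/
abbrev BilinField (n : ℕ) : Type := Cn n → (Cn n →L[ℝ] Cn n →L[ℝ] ℝ)

/-- The standard complex structure `J₀`, multiplication by `√-1`. -/
def J₀ (n : ℕ) : Cn n →L[ℝ] Cn n :=
  (Complex.I • ContinuousLinearMap.id ℂ (Cn n)).restrictScalars ℝ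

theorem J₀_apply {n : ℕ} (X : Cn n) : J₀ n X = Complex.I • X := rfl

/-- The radial variable `𝐳 = ∑ |zᵢ|²`. -/
def radial {n : ℕ} (p : Cn n) : ℝ := ∑ i, ‖p i‖ ^ 2

/-- The interval `(α, β)`, where `β = ∞` is allowed. -/
def radialInterval (α : ℝ) (β : EReal) : Set ℝ := {t | α < t ∧ (t : EReal) < β}

/-- The annulus `{α < 𝐳 < β}` in `ℂⁿ`. -/
def annulus (n : ℕ) (α : ℝ) (β : EReal) : Set (Cn n) := {p | radial p ∈ radialInterval α β}

/-! ### Hermitian and Kähler metrics -/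

/-- `g` is a smooth Riemannian metric on `U` that is Hermitian with respect to `J₀`. -/
structure IsHermitianMetricOn {n : ℕ} (g : BilinField n) (U : Set (Cn n)) : Prop where
  smooth : ContDiffOn ℝ ∞ g U
  symm : ∀ p ∈ U, ∀ X Y, g p X Y = g p Y X
  pos : ∀ p ∈ U, ∀ X, X ≠ 0 → 0 < g p X X
  hermitian : ∀ p ∈ U, ∀ X Y, g p (J₀ n X) (J₀ n Y) = g p X Y

/-- The associated `2`-form `ω(X, Y) = g(J₀ X, Y)`, written in skew-symmetrized form
`(g(J₀ X, Y) - g(J₀ Y, X)) / 2`, so that it is an alternating form for every `g`. -/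
def fundamentalForm {n : ℕ} (g : BilinField n) (p : Cn n) : Cn n [⋀^Fin 2]→L[ℝ] ℝ :=
  (1 / 2 : ℝ) • ContinuousAlternatingMap.alternatizeUncurryFin
    ((ContinuousAlternatingMap.ofSubsingletonLIE (𝕜 := ℝ) (E := Cn n) (F := ℝ)
        (0 : Fin 1)).toContinuousLinearEquiv.toContinuousLinearMap ∘L (g p) ∘L (J₀ n))

theorem fundamentalForm_apply {n : ℕ} (g : BilinField n) (p : Cn n) (v : Fin 2 → Cn n) :
    fundamentalForm g p v = (g p (J₀ n (v 0)) (v 1) - g p (J₀ n (v 1)) (v 0)) / 2 := by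
  simp [fundamentalForm, ContinuousAlternatingMap.alternatizeUncurryFin_apply, Fin.sum_univ_two,
    Fin.removeNth]
  ring

/-- For a Hermitian metric the associated `2`-form is `ω(X, Y) = g(J₀ X, Y)`. -/
theorem IsHermitianMetricOn.fundamentalForm_apply {n : ℕ} {g : BilinField n} {U : Set (Cn n)}
    (hg : IsHermitianMetricOn g U) {p : Cn n} (hp : p ∈ U) (v : Fin 2 → Cn n) :
    fundamentalForm g p v = g p (J₀ n (v 0)) (v 1) := by
  have h1 := hg.hermitian p hp (J₀ n (v 1)) (v 0)
  have h2 : J₀ n (J₀ n (v 1)) = -(v 1) := by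
    simp [J₀_apply, smul_smul]
  rw [h2, map_neg, neg_apply, hg.symm p hp] at h1
  rw [HermitianKlsc.fundamentalForm_apply, ← h1]
  ring

/-- `g` is a Kähler metric on `U`: a Hermitian metric whose associated `2`-form is closed. -/
structure IsKahlerMetricOn {n : ℕ} (g : BilinField n) (U : Set (Cn n)) : Prop where
  isHermitian : IsHermitianMetricOn g U
  closed : ∀ p ∈ U, extDeriv (fundamentalForm g) p = 0

/-! ### The Riemannian scalar curvature -/

/-- The real coordinate frame `∂/∂x₁, …, ∂/∂xₙ, ∂/∂y₁, …, ∂/∂yₙ`, where `zᵢ = xᵢ + √-1 yᵢ`. -/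
def realFrame {n : ℕ} : Fin n ⊕ Fin n → Cn n
  | Sum.inl i => EuclideanSpace.single i 1
  | Sum.inr i => EuclideanSpace.single i Complex.I

/-- The partial derivative of a real function in the direction of the `a`-th real coordinate. -/
def partialDeriv {n : ℕ} (a : Fin n ⊕ Fin n) (f : Cn n → ℝ) (p : Cn n) : ℝ :=
  fderiv ℝ f p (realFrame a)

/-- The matrix `g_{ab}` of the metric in the real coordinate frame. -/
def gramMatrix {n : ℕ} (g : BilinField n) (p : Cn n) : Matrix (Fin n ⊕ Fin n) (Fin n ⊕ Fin n) ℝ :=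
  Matrix.of fun a b => g p (realFrame a) (realFrame b)

/-- Christoffel symbols `Γᶜ_{ab}` of the Levi-Civita connection. -/
def christoffel {n : ℕ} (g : BilinField n) (c a b : Fin n ⊕ Fin n) (p : Cn n) : ℝ :=
  (1 / 2) * ∑ d, (gramMatrix g p)⁻¹ c d *
    (partialDeriv a (fun q => gramMatrix g q b d) p
      + partialDeriv b (fun q => gramMatrix g q a d) p
      - partialDeriv d (fun q => gramMatrix g q a b) p)

/-- Components `Rᵈ_{cab}` of the Riemann tensor,
`R(∂ₐ, ∂_b) ∂_c = ∇ₐ ∇_b ∂_c - ∇_b ∇ₐ ∂_c = Rᵈ_{cab} ∂_d`. -/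
def riemann {n : ℕ} (g : BilinField n) (d c a b : Fin n ⊕ Fin n) (p : Cn n) : ℝ :=
  partialDeriv a (christoffel g d b c) p - partialDeriv b (christoffel g d a c) p
    + ∑ e, (christoffel g d a e p * christoffel g e b c p
        - christoffel g d b e p * christoffel g e a c p)

/-- The Ricci tensor `Ric_{bc} = Rᵃ_{cab}`. -/
def ricci {n : ℕ} (g : BilinField n) (b c : Fin n ⊕ Fin n) (p : Cn n) : ℝ :=
  ∑ a, riemann g a c a b p

/-- The Riemannian scalar curvature `S = g^{bc} Ric_{bc}`. -/
def scalarCurvature {n : ℕ} (g : BilinField n) (p : Cn n) : ℝ :=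
  ∑ b, ∑ c, (gramMatrix g p)⁻¹ b c * ricci g b c p

/-! ### The Chern scalar curvature -/

/-- `∂f/∂zᵢ = (∂f/∂xᵢ - √-1 ∂f/∂yᵢ) / 2`. -/
def dz {n : ℕ} (i : Fin n) (f : Cn n → ℂ) (p : Cn n) : ℂ :=
  (1 / 2) * (fderiv ℝ f p (realFrame (Sum.inl i))
    - Complex.I * fderiv ℝ f p (realFrame (Sum.inr i)))

/-- `∂f/∂z̄ᵢ = (∂f/∂xᵢ + √-1 ∂f/∂yᵢ) / 2`. -/
def dzbar {n : ℕ} (i : Fin n) (f : Cn n → ℂ) (p : Cn n) : ℂ :=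
  (1 / 2) * (fderiv ℝ f p (realFrame (Sum.inl i))
    + Complex.I * fderiv ℝ f p (realFrame (Sum.inr i)))

/-- The matrix `g_{ij̄} = g(∂/∂zᵢ, ∂/∂z̄ⱼ)`, with `g` extended complex bilinearly to the
complexified tangent space. For a Hermitian metric, `ω = √-1 ∑ g_{ij̄} dzᵢ ∧ dz̄ⱼ`. -/
def hermMatrix {n : ℕ} (g : BilinField n) (p : Cn n) : Matrix (Fin n) (Fin n) ℂ :=
  Matrix.of fun i j =>
    (1 / 4 : ℂ) *
      ((g p (realFrame (Sum.inl i)) (realFrame (Sum.inl j)) : ℂ)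
        + (g p (realFrame (Sum.inr i)) (realFrame (Sum.inr j)) : ℂ)
        + Complex.I * ((g p (realFrame (Sum.inl i)) (realFrame (Sum.inr j)) : ℂ)
          - (g p (realFrame (Sum.inr i)) (realFrame (Sum.inl j)) : ℂ)))

/-- The inverse metric `g^{ij̄}`, normalized by `∑ⱼ g^{ij̄} g_{kj̄} = δᵢₖ`. -/
def hermInverse {n : ℕ} (g : BilinField n) (i j : Fin n) (p : Cn n) : ℂ :=
  (hermMatrix g p)⁻¹ j i

/-- The coefficients of the Chern connection of `(T^{1,0}, g)`:
`∇_{∂/∂zᵢ} (∂/∂zₖ) = ∑ₚ Γᵖ_{ik} ∂/∂zₚ` with `Γᵖ_{ik} = g^{pq̄} ∂ᵢ g_{kq̄}` (and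
`∇_{∂/∂z̄ᵢ} (∂/∂zₖ) = 0`). -/
def chernConnection {n : ℕ} (g : BilinField n) (p' i k : Fin n) (p : Cn n) : ℂ :=
  ∑ q, hermInverse g p' q p * dz i (fun x => hermMatrix g x k q) p

/-- The curvature tensor of the Chern connection,
`Θ_{ij̄kl̄} = g([∇_{∂/∂zᵢ}, ∇_{∂/∂z̄ⱼ}] ∂/∂zₖ, ∂/∂z̄ₗ) = - ∑ₚ (∂_{j̄} Γᵖ_{ik}) g_{pl̄}`. -/
def chernCurvature {n : ℕ} (g : BilinField n) (i j k l : Fin n) (p : Cn n) : ℂ :=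
  -∑ p', dzbar j (chernConnection g p' i k) p * hermMatrix g p p' l

/-- The Chern-Ricci curvature `Θ_{ij̄} = g^{kl̄} Θ_{ij̄kl̄}`. -/
def chernRicci {n : ℕ} (g : BilinField n) (i j : Fin n) (p : Cn n) : ℂ :=
  ∑ k, ∑ l, hermInverse g k l p * chernCurvature g i j k l p

/-- The Chern scalar curvature `S_C = g^{ij̄} Θ_{ij̄}`. -/
def chernScalarCurvature {n : ℕ} (g : BilinField n) (p : Cn n) : ℂ :=
  ∑ i, ∑ j, hermInverse g i j p * chernRicci g i j p

/-! ### The objects of the theorem -/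

/-- `g` is, on `U`, a non-Kähler Hermitian metric with `S = 2 S_C`. -/
structure IsNonKahlerKlscOn {n : ℕ} (g : BilinField n) (U : Set (Cn n)) : Prop where
  isHermitian : IsHermitianMetricOn g U
  not_kahler : ¬ IsKahlerMetricOn g U
  scalar_eq : ∀ p ∈ U, (scalarCurvature g p : ℂ) = 2 * chernScalarCurvature g p

/-- `φ(𝐳)` is a smooth potential of `g` on the annulus: `g_{ij̄} = ∂ᵢ ∂_{j̄} φ(𝐳)`, i.e.
`ω = √-1 ∂ ∂̄ φ(𝐳)`. -/
structure HasRadialPotential {n : ℕ} (g : BilinField n) (φ : ℝ → ℝ) (α : ℝ) (β : EReal) : Prop where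
  smooth : ContDiffOn ℝ ∞ φ (radialInterval α β)
  potential : ∀ p ∈ annulus n α β, ∀ i j,
    hermMatrix g p i j = dz i (dzbar j (fun x => (φ (radial x) : ℂ))) p

/-- The conformal metric `κ g`. -/
def conformal {n : ℕ} (κ : Cn n → ℝ) (g : BilinField n) : BilinField n := fun p => κ p • g p

/-- `κ` is a smooth positive function on `U` that is invariant under the unitary group `U(n)`. -/
structure IsUnitaryInvariantFactorOn {n : ℕ} (κ : Cn n → ℝ) (U : Set (Cn n)) : Prop where
  smooth : ContDiffOn ℝ ∞ κ U
  pos : ∀ p ∈ U, 0 < κ p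
  invariant : ∀ A : Cn n ≃ₗᵢ[ℂ] Cn n, ∀ p ∈ U, κ (A p) = κ p

/-- `H` is one of the functions `∫ d𝐳 / (𝐳ⁿ (φ')ⁿ⁻¹)` on `(α, β)`. -/
def IsAntiderivative (n : ℕ) (φ : ℝ → ℝ) (α : ℝ) (β : EReal) (H : ℝ → ℝ) : Prop :=
  ∀ t ∈ radialInterval α β, HasDerivAt H (1 / (t ^ n * deriv φ t ^ (n - 1))) t

/-- `v = H(𝐳)^{1/(2n-1)}` as a function on `ℂⁿ`, up to the sign of the odd root, which does not
affect `v²`. -/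
def factorV (n : ℕ) (H : ℝ → ℝ) (p : Cn n) : ℝ := |H (radial p)| ^ (1 / (2 * (n : ℝ) - 1))

end HermitianKlsc

end

/-!
Everything is reduced to functions of the radial variable `t = 𝐳`. Write `f = φ'` and
`s = f + t f' = (t φ')'`. In the real frame the Kähler metric is
`g = 2 f ⟨·,·⟩ + 2 f' (x ⊗ x + Jx ⊗ Jx)`, so positivity of `g` says exactly that `f > 0` and `s > 0`
(this uses `n ≥ 2`), and a conformal metric `κ g` with `κ = k(t)` has the same shape.

*Curvature.* For a metric `a(t) ⟨·,·⟩ + b(t) (x ⊗ x + Jx ⊗ Jx)` the Christoffel symbols are a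
combination of six tensors built from `x`, `Jx`, `δ` and `J`, with radial coefficients
(`radialSymbol`). The contractions that make up the Ricci tensor become traces of products of
matrices of the form `λ 1 + μ J + (rank one terms)`, and the result is
`Ric = ρ ⟨·,·⟩ + σ x ⊗ x + τ Jx ⊗ Jx` (`ricci_of_christoffel`). On the Chern side
`∑ₖ Γᵏ_{ik} = ℓ(t) z̄ᵢ` is `∂ᵢ log det (g_{kl̄})`, so that the Chern-Ricci form is
`-(ℓ δᵢⱼ + ℓ' z̄ᵢ zⱼ)` (`chernScalarCurvature_of_radialHerm`).

*The equation.* With `l = (log k)'` the two scalar curvatures of `κ g` satisfy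
`S - 2 S_C = -(2n - 2) / k · ((n - 1) l / f + (l + t l' + (n - 1/2) t l²) / s)`
(`scalarCurvature_eq_two_mul_chern_iff`). Putting `k = u ^ (2 / (2n - 1))` linearizes this:
`S = 2 S_C` iff `(n - 1) u' / f + (u' + t u'') / s = 0`, which says that `u(𝐳)` is
harmonic for `g`. Up to the positive factor `tⁿ⁻¹ fⁿ⁻¹ s`, the left-hand side is the
derivative of the flux `tⁿ fⁿ⁻¹ u'` (`hasDerivAt_flux`). Hence `S = 2 S_C` iff `u' = C / (tⁿ (φ')ⁿ⁻¹)` for a constant `C`.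

*The Kähler condition.* As `ω` is closed, `d(κ ω) = dκ ∧ ω`. Evaluated at a point of the first
complex axis on `(e₀, e₁, J e₁)` this is a nonzero multiple of `k'`
(`deriv_eq_zero_of_closed`), so that `κ g` is Kähler iff `k` is constant, i.e. iff `C = 0`. If
`C ≠ 0`, then `u / C` is one of the functions `H`.

*Zeros of `H`.* `H' > 0` gives injectivity. Since `tⁿ (φ')ⁿ⁻¹ = t (t φ')ⁿ⁻¹` is increasing, `H` is
concave; so it lies below a tangent line and is bounded above on a bounded interval.
-/

open scoped ContDiff

noncomputable section

namespace HermitianKlsc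

/-! ### Linear algebra of the vectors `x`, `Jx` and the tensors built from them -/

section FrameAlgebra

open Matrix

variable {ι : Type*} [DecidableEq ι]

/-- The general shape `Γᵈ_{bc}` of the Christoffel symbols of a metric built from `x`, `w = Jx`:
`A (x_b δᵈ_c + x_c δᵈ_b) + B xᵈ δ_{bc} + C (w_c Jᵈ_b + w_b Jᵈ_c) + D xᵈ x_b x_c + E xᵈ w_b w_c
+ F wᵈ (x_b w_c + w_b x_c)`. -/
def radialSymbol (A B C D E F : ℝ) (x w : ι → ℝ) (J : Matrix ι ι ℝ) (d b c : ι) : ℝ :=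
  A * (x b * (1 : Matrix ι ι ℝ) d c + x c * (1 : Matrix ι ι ℝ) d b)
    + B * (x d * (1 : Matrix ι ι ℝ) b c)
    + C * (w c * J d b + w b * J d c) + D * (x d * x b * x c) + E * (x d * w b * w c)
    + F * (w d * (x b * w c + w b * x c))

theorem radialSymbol_comm (A B C D E F : ℝ) (x w : ι → ℝ) (J : Matrix ι ι ℝ) (d b c : ι) :
    radialSymbol A B C D E F x w J d b c = radialSymbol A B C D E F x w J d c b := by
  have : (1 : Matrix ι ι ℝ) b c = (1 : Matrix ι ι ℝ) c b := by
    simp only [Matrix.one_apply, eq_comm]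
  simp only [radialSymbol, this]
  ring

/-- The Gram matrix `a δ + b (x ⊗ x + w ⊗ w)`. On the span of `x` and `w` it acts as the scalar
`a + |x|² b`, and on the orthogonal complement as `a`. -/
def radialGram (a b : ℝ) (x w : ι → ℝ) : Matrix ι ι ℝ :=
  a • 1 + b • (vecMulVec x x + vecMulVec w w)

theorem radialGram_apply (a b : ℝ) (x w : ι → ℝ) (i j : ι) :
    radialGram a b x w i j = a * (1 : Matrix ι ι ℝ) i j + b * (x i * x j + w i * w j) := by
  simp [radialGram, vecMulVec_apply]
  ring

variable [Fintype ι]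

/-- `w = J x` for a skew-symmetric orthogonal complex structure `J` on `ℝ^ι`. -/
structure IsRotatedPair (x w : ι → ℝ) (J : Matrix ι ι ℝ) : Prop where
  skew : J.transpose = -J
  sq : J * J = -1
  rot : J.mulVec x = w

namespace IsRotatedPair

variable {x w : ι → ℝ} {J : Matrix ι ι ℝ}

theorem rot' (h : IsRotatedPair x w J) : J *ᵥ w = -x := by
  rw [← h.rot, mulVec_mulVec, h.sq, neg_mulVec, one_mulVec]

theorem vecMul (h : IsRotatedPair x w J) (u : ι → ℝ) : u ᵥ* J = -(J *ᵥ u) := by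
  rw [← mulVec_transpose, h.skew, neg_mulVec]

theorem dot_comm (h : IsRotatedPair x w J) (u v : ι → ℝ) : u ⬝ᵥ J *ᵥ v = -(v ⬝ᵥ J *ᵥ u) := by
  rw [dotProduct_mulVec, h.vecMul, neg_dotProduct, dotProduct_comm]

theorem dot_self (h : IsRotatedPair x w J) (u : ι → ℝ) : u ⬝ᵥ J *ᵥ u = 0 := by
  have := h.dot_comm u u
  linarith

theorem dot_rot_rot (h : IsRotatedPair x w J) (u v : ι → ℝ) : J *ᵥ u ⬝ᵥ J *ᵥ v = u ⬝ᵥ v := by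
  rw [h.dot_comm, mulVec_mulVec, h.sq, neg_mulVec, one_mulVec, dotProduct_neg, neg_neg,
    dotProduct_comm]

theorem dot_x (h : IsRotatedPair x w J) (u : ι → ℝ) : x ⬝ᵥ J *ᵥ u = -(w ⬝ᵥ u) := by
  rw [h.dot_comm, h.rot, dotProduct_comm]

theorem dot_w (h : IsRotatedPair x w J) (u : ι → ℝ) : w ⬝ᵥ J *ᵥ u = x ⬝ᵥ u := by
  rw [h.dot_comm, h.rot', dotProduct_neg, neg_neg, dotProduct_comm]

theorem dot_xw (h : IsRotatedPair x w J) : x ⬝ᵥ w = 0 := by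
  rw [← h.rot, h.dot_self]

theorem dot_wx (h : IsRotatedPair x w J) : w ⬝ᵥ x = 0 := by
  rw [dotProduct_comm, h.dot_xw]

theorem dot_ww (h : IsRotatedPair x w J) : w ⬝ᵥ w = x ⬝ᵥ x := by
  rw [← h.rot, h.dot_rot_rot]

theorem trace (h : IsRotatedPair x w J) : J.trace = 0 := by
  have := congrArg Matrix.trace h.skew
  rw [trace_transpose, trace_neg] at this
  linarith

end IsRotatedPair

/-- The endomorphism `v ↦ Γ(u, v)` for the symbol `Γ = radialSymbol A B C D E F x w J`; contractions
of `Γ` are traces and products of these matrices. -/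
def symbolMatrix (A B C D E F : ℝ) (x w : ι → ℝ) (J : Matrix ι ι ℝ) (u : ι → ℝ) : Matrix ι ι ℝ :=
  (A * x ⬝ᵥ u) • 1 + A • vecMulVec u x + B • vecMulVec x u + C • vecMulVec (J *ᵥ u) w
    + (C * w ⬝ᵥ u) • J + (D * x ⬝ᵥ u) • vecMulVec x x + (E * w ⬝ᵥ u) • vecMulVec x w
    + (F * x ⬝ᵥ u) • vecMulVec w w + (F * w ⬝ᵥ u) • vecMulVec w x

/-- The quadratic contraction `Γᵃ_{ue} Γᵉ_{va}`. -/
theorem trace_symbolMatrix_mul {x w : ι → ℝ} {J : Matrix ι ι ℝ} (h : IsRotatedPair x w J)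
    (A B C D E F : ℝ) (u v : ι → ℝ) {t m : ℝ} (ht : x ⬝ᵥ x = t) (hm : (Fintype.card ι : ℝ) = m) :
    (symbolMatrix A B C D E F x w J u * symbolMatrix A B C D E F x w J v).trace
      = 2 * A * B * t * u ⬝ᵥ v
        + ((m - 2) * A ^ 2 + (2 * A + B + D * t) ^ 2 + (A + C + F * t) ^ 2 - 2 * A * B)
          * (x ⬝ᵥ u * x ⬝ᵥ v)
        + (2 * (A + F * t) * (B - C + E * t) - m * C ^ 2
            + 2 * C * ((B - C + E * t) - (A + F * t)) - 2 * A * B) * (w ⬝ᵥ u * w ⬝ᵥ v) := by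
  have e1 : u ⬝ᵥ J *ᵥ v = -(v ⬝ᵥ J *ᵥ u) := h.dot_comm u v
  simp only [symbolMatrix, Matrix.add_mul, Matrix.mul_add, Matrix.smul_mul, Matrix.mul_smul,
    Matrix.one_mul, Matrix.mul_one]
  simp only [vecMulVec_mul_vecMulVec, trace_add, trace_smul]
  simp only [mul_vecMulVec, vecMulVec_mul, trace_vecMulVec,
    trace_one, h.trace, h.sq, trace_neg, h.vecMul, smul_eq_mul,
    h.rot, h.rot', dotProduct_neg, neg_dotProduct, dotProduct_smul,
    hm, mulVec_mulVec, neg_mulVec, one_mulVec]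
  simp only [dotProduct_comm u x, dotProduct_comm v x, dotProduct_comm u w,
    dotProduct_comm v w, dotProduct_comm (J *ᵥ u) x, dotProduct_comm (J *ᵥ v) x,
    dotProduct_comm (J *ᵥ u) w, dotProduct_comm (J *ᵥ v) w, h.dot_x, h.dot_w, h.dot_xw,
    h.dot_wx, h.dot_ww, ht, dotProduct_comm (J *ᵥ u) v, e1]
  ring

theorem trace_symbolMatrix {x w : ι → ℝ} {J : Matrix ι ι ℝ} (h : IsRotatedPair x w J)
    (A B C D E F : ℝ) (u : ι → ℝ) {t m : ℝ} (ht : x ⬝ᵥ x = t) (hm : (Fintype.card ι : ℝ) = m) :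
    (symbolMatrix A B C D E F x w J u).trace
      = ((m + 1) * A + B + C + (D + F) * t) * x ⬝ᵥ u := by
  simp only [symbolMatrix, trace_add, trace_smul, trace_vecMulVec, trace_one, h.trace, smul_eq_mul,
    hm, h.dot_xw, h.dot_wx, h.dot_ww, ht, dotProduct_comm u x, dotProduct_comm (J *ᵥ u) w, h.dot_w]
  ring

theorem symbolMatrix_mulVec (A B C D E F : ℝ) (x w : ι → ℝ) (J : Matrix ι ι ℝ) (u v : ι → ℝ) :
    symbolMatrix A B C D E F x w J u *ᵥ v
      = (A * x ⬝ᵥ u) • v + (A * x ⬝ᵥ v) • u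
        + (C * w ⬝ᵥ v) • (J *ᵥ u) + (C * w ⬝ᵥ u) • (J *ᵥ v)
        + (B * u ⬝ᵥ v + D * x ⬝ᵥ u * x ⬝ᵥ v + E * w ⬝ᵥ u * w ⬝ᵥ v) • x
        + (F * (x ⬝ᵥ u * w ⬝ᵥ v + w ⬝ᵥ u * x ⬝ᵥ v)) • w := by
  ext i
  simp [symbolMatrix, add_mulVec, smul_mulVec, vecMulVec_mulVec]
  ring

theorem dotProduct_symbolMatrix_mulVec {x w : ι → ℝ} {J : Matrix ι ι ℝ} (h : IsRotatedPair x w J)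
    (A B C D E F : ℝ) (u v : ι → ℝ) {t : ℝ} (ht : x ⬝ᵥ x = t) :
    x ⬝ᵥ symbolMatrix A B C D E F x w J u *ᵥ v
      = B * t * u ⬝ᵥ v + (2 * A + D * t) * (x ⬝ᵥ u * x ⬝ᵥ v)
        + (-2 * C + E * t) * (w ⬝ᵥ u * w ⬝ᵥ v) := by
  simp only [symbolMatrix_mulVec, dotProduct_add, dotProduct_smul, h.dot_x, h.dot_xw, ht,
    smul_eq_mul]
  ring

theorem radialSymbol_eq_symbolMatrix (A B C D E F : ℝ) (x w : ι → ℝ) (J : Matrix ι ι ℝ)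
    (d b c : ι) :
    radialSymbol A B C D E F x w J d b c
      = symbolMatrix A B C D E F x w J (Pi.single b 1) d c := by
  simp only [radialSymbol, symbolMatrix, Matrix.add_apply, Matrix.smul_apply, vecMulVec_apply,
    smul_eq_mul, dotProduct_single_one, mulVec_single_one, Matrix.col_apply, Pi.single_apply,
    Matrix.one_apply]
  simp only [show (b = c) = (c = b) from propext eq_comm]
  ring

theorem sum_radialSymbol_mul {x w : ι → ℝ} {J : Matrix ι ι ℝ} (h : IsRotatedPair x w J)
    (A B C D E F : ℝ) (b c : ι) {t m : ℝ} (ht : x ⬝ᵥ x = t) (hm : (Fintype.card ι : ℝ) = m) :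
    ∑ a, ∑ e, radialSymbol A B C D E F x w J a b e * radialSymbol A B C D E F x w J e a c
      = 2 * A * B * t * (1 : Matrix ι ι ℝ) b c
        + ((m - 2) * A ^ 2 + (2 * A + B + D * t) ^ 2 + (A + C + F * t) ^ 2 - 2 * A * B)
          * (x b * x c)
        + (2 * (A + F * t) * (B - C + E * t) - m * C ^ 2
            + 2 * C * ((B - C + E * t) - (A + F * t)) - 2 * A * B) * (w b * w c) := by
  have := trace_symbolMatrix_mul h A B C D E F (Pi.single b 1) (Pi.single c 1) ht hm
  simp only [dotProduct_single_one] at this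
  rw [show (1 : Matrix ι ι ℝ) b c = (Pi.single b 1 : ι → ℝ) c by
    simp [Matrix.one_apply, Pi.single_apply, eq_comm], ← this]
  simp only [Matrix.trace, Matrix.diag, Matrix.mul_apply]
  refine Finset.sum_congr rfl fun a _ => Finset.sum_congr rfl fun e _ => ?_
  rw [radialSymbol_comm _ _ _ _ _ _ _ _ _ e, radialSymbol_eq_symbolMatrix,
    radialSymbol_eq_symbolMatrix]

theorem sum_radialSymbol_diag {x w : ι → ℝ} {J : Matrix ι ι ℝ} (h : IsRotatedPair x w J)
    (A B C D E F : ℝ) (c : ι) {t m : ℝ} (ht : x ⬝ᵥ x = t) (hm : (Fintype.card ι : ℝ) = m) :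
    ∑ a, radialSymbol A B C D E F x w J a a c
      = ((m + 1) * A + B + C + (D + F) * t) * x c := by
  have := trace_symbolMatrix h A B C D E F (Pi.single c 1) ht hm
  rw [dotProduct_single_one] at this
  rw [← this, Matrix.trace]
  refine Finset.sum_congr rfl fun a _ => ?_
  rw [radialSymbol_comm, radialSymbol_eq_symbolMatrix, Matrix.diag]

theorem sum_mul_radialSymbol {x w : ι → ℝ} {J : Matrix ι ι ℝ} (h : IsRotatedPair x w J)
    (A B C D E F : ℝ) (b c : ι) {t : ℝ} (ht : x ⬝ᵥ x = t) :
    ∑ e, x e * radialSymbol A B C D E F x w J e b c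
      = B * t * (1 : Matrix ι ι ℝ) b c + (2 * A + D * t) * (x b * x c)
        + (-2 * C + E * t) * (w b * w c) := by
  have := dotProduct_symbolMatrix_mulVec h A B C D E F (Pi.single b 1) (Pi.single c 1) ht
  simp only [dotProduct_single_one] at this
  rw [show (1 : Matrix ι ι ℝ) b c = (Pi.single b 1 : ι → ℝ) c by
    simp [Matrix.one_apply, Pi.single_apply, eq_comm], ← this]
  simp [dotProduct, radialSymbol_eq_symbolMatrix]

theorem radialGram_mulVec (a b : ℝ) (x w y : ι → ℝ) :
    radialGram a b x w *ᵥ y = a • y + (b * x ⬝ᵥ y) • x + (b * w ⬝ᵥ y) • w := by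
  ext i
  simp [radialGram, add_mulVec, smul_mulVec, vecMulVec_mulVec]
  ring

theorem radialGram_mul_inv {x w : ι → ℝ} {J : Matrix ι ι ℝ} (h : IsRotatedPair x w J)
    {a b t s : ℝ} (ht : x ⬝ᵥ x = t) (ha : a ≠ 0) (hs : a + t * b = s) (hs0 : s ≠ 0) :
    radialGram a b x w * radialGram (1 / a) (-(b / (a * s))) x w = 1 := by
  simp only [radialGram, Matrix.add_mul, Matrix.mul_add, Matrix.smul_mul, Matrix.mul_smul,
    Matrix.one_mul, Matrix.mul_one]
  simp only [vecMulVec_mul_vecMulVec, h.dot_xw, h.dot_wx, h.dot_ww, ht]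
  ext i j
  simp [vecMulVec_apply]
  field_simp
  rw [← hs]
  ring

theorem radialGram_inv {x w : ι → ℝ} {J : Matrix ι ι ℝ} (h : IsRotatedPair x w J)
    {a b t s : ℝ} (ht : x ⬝ᵥ x = t) (ha : a ≠ 0) (hs : a + t * b = s) (hs0 : s ≠ 0) :
    (radialGram a b x w)⁻¹ = radialGram (1 / a) (-(b / (a * s))) x w :=
  Matrix.inv_eq_right_inv (radialGram_mul_inv h ht ha hs hs0)

/-- Lowering the index of this symbol gives the Christoffel symbols of the first kind of
`a δ + b (x ⊗ x + w ⊗ w)`; here `a₁`, `b₁` stand for the derivatives of `a`, `b` with respect to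
`t = |x|²`, and `s = a + t b`. -/
theorem radialGram_mulVec_symbolMatrix {x w : ι → ℝ} {J : Matrix ι ι ℝ} (h : IsRotatedPair x w J)
    {a b t s : ℝ} (a₁ b₁ : ℝ) (ht : x ⬝ᵥ x = t) (ha : a ≠ 0) (hs : a + t * b = s) (hs0 : s ≠ 0)
    (u v : ι → ℝ) :
    radialGram a b x w *ᵥ (symbolMatrix (a₁ / a) ((b - a₁) / s) (b / a)
        (2 * ((b₁ * a - b * a₁) / (a * s)) - b₁ / s)
        (2 * b ^ 2 / (a * s) - b₁ / s)
        ((b₁ * a - b * a₁) / (a * s) - b ^ 2 / (a * s)) x w J u *ᵥ v)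
      = (x ⬝ᵥ u) • (radialGram a₁ b₁ x w *ᵥ v) + (x ⬝ᵥ v) • (radialGram a₁ b₁ x w *ᵥ u)
        - (u ⬝ᵥ radialGram a₁ b₁ x w *ᵥ v) • x
        + b • ((u ⬝ᵥ v) • x + (w ⬝ᵥ v) • (J *ᵥ u) + (w ⬝ᵥ u) • (J *ᵥ v)) := by
  simp only [radialGram_mulVec, symbolMatrix_mulVec, dotProduct_add, dotProduct_smul, h.dot_x,
    h.dot_w, h.dot_xw, h.dot_wx, h.dot_ww, ht, smul_eq_mul, dotProduct_comm u x,
    dotProduct_comm u w]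
  ext i
  simp only [Pi.add_apply, Pi.sub_apply, Pi.smul_apply, smul_eq_mul]
  field_simp
  rw [← hs]
  ring

/-- The trace of `ρ δ + σ x ⊗ x + τ w ⊗ w` with respect to the metric `a δ + b (x ⊗ x + w ⊗ w)`. -/
theorem sum_radialGram_mul {x w : ι → ℝ} {J : Matrix ι ι ℝ} (h : IsRotatedPair x w J)
    {a b t m s : ℝ} (ht : x ⬝ᵥ x = t) (hm : (Fintype.card ι : ℝ) = m) (ha : a ≠ 0)
    (hs : a + t * b = s) (hs0 : s ≠ 0) (ρ σ τ : ℝ) :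
    ∑ i, ∑ j, (radialGram a b x w)⁻¹ i j
        * (ρ * (1 : Matrix ι ι ℝ) i j + σ * (x i * x j) + τ * (w i * w j))
      = (m - 2) * ρ / a + (2 * ρ + (σ + τ) * t) / s := by
  have key : ∀ i, ∑ j, (radialGram a b x w)⁻¹ i j
        * (ρ * (1 : Matrix ι ι ℝ) i j + σ * (x i * x j) + τ * (w i * w j))
      = ((radialGram a b x w)⁻¹ * (ρ • 1 + σ • vecMulVec x x + τ • vecMulVec w w)).diag i := by
    intro i
    rw [Matrix.diag, Matrix.mul_apply]
    refine Finset.sum_congr rfl fun j _ => ?_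
    have : (1 : Matrix ι ι ℝ) i j = (1 : Matrix ι ι ℝ) j i := by
      simp only [Matrix.one_apply, eq_comm]
    simp [vecMulVec_apply, this]
    ring_nf
    tauto
  rw [Finset.sum_congr rfl fun i _ => key i, ← Matrix.trace, radialGram_inv h ht ha hs hs0]
  simp only [radialGram, Matrix.add_mul, Matrix.mul_add, Matrix.smul_mul, Matrix.mul_smul,
    Matrix.one_mul, Matrix.mul_one]
  simp only [vecMulVec_mul_vecMulVec, h.dot_xw, h.dot_wx, h.dot_ww, ht, trace_add, trace_smul,
    trace_vecMulVec, trace_one, hm, smul_eq_mul, zero_smul, vecMulVec_zero,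
    trace_zero, smul_add, vecMulVec_smul]
  field_simp
  rw [← hs]
  ring

end FrameAlgebra

/-! ### Partial derivatives in real coordinates -/

section RealCalculus

open Matrix

variable {n : ℕ}

/-- The real coordinates `(x₁, …, xₙ, y₁, …, yₙ)` of a point of `ℂⁿ`, in the order of
`realFrame`. -/
def realCoord (p : Cn n) : Fin n ⊕ Fin n → ℝ
  | Sum.inl i => (p i).re
  | Sum.inr i => (p i).im

/-- The real coordinates of `J₀ p`. -/
def rotCoord (p : Cn n) : Fin n ⊕ Fin n → ℝ
  | Sum.inl i => -(p i).im
  | Sum.inr i => (p i).re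

theorem isRotatedPair (p : Cn n) :
    IsRotatedPair (realCoord p) (rotCoord p) (Matrix.J (Fin n) ℝ) where
  skew := Matrix.J_transpose _ _
  sq := Matrix.J_squared _ _
  rot := by
    ext (i | i) <;>
      simp [Matrix.J, Matrix.fromBlocks, mulVec, dotProduct, realCoord, rotCoord,
        Matrix.one_apply]

theorem dotProduct_realCoord (p : Cn n) : realCoord p ⬝ᵥ realCoord p = radial p := by
  simp [dotProduct, realCoord, radial, Complex.sq_norm, Complex.normSq_apply,
    Finset.sum_add_distrib]

theorem card_frame (n : ℕ) : (Fintype.card (Fin n ⊕ Fin n) : ℝ) = 2 * n := by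
  simp
  ring

/-- `f` is differentiable at `p` and its partial derivative in the direction of the `a`-th real
coordinate is `f'`. -/
structure HasPartialDerivAt (f : Cn n → ℝ) (f' : ℝ) (a : Fin n ⊕ Fin n) (p : Cn n) : Prop where
  differentiableAt : DifferentiableAt ℝ f p
  eq : partialDeriv a f p = f'

namespace HasPartialDerivAt

variable {f g : Cn n → ℝ} {f' g' : ℝ} {a : Fin n ⊕ Fin n} {p : Cn n}

theorem of_hasFDerivAt {L : Cn n →L[ℝ] ℝ} (h : HasFDerivAt f L p) :
    HasPartialDerivAt f (L (realFrame a)) a p :=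
  ⟨h.differentiableAt, by rw [partialDeriv, h.fderiv]⟩

theorem congr_val {f'' : ℝ} (h : HasPartialDerivAt f f' a p) (e : f' = f'') :
    HasPartialDerivAt f f'' a p := e ▸ h

theorem congr_of_eventuallyEq (h : HasPartialDerivAt f f' a p) (e : g =ᶠ[nhds p] f) :
    HasPartialDerivAt g f' a p :=
  ⟨h.differentiableAt.congr_of_eventuallyEq e, by rw [partialDeriv, e.fderiv_eq]; exact h.eq⟩

theorem const (c : ℝ) : HasPartialDerivAt (fun _ => c) 0 a p :=
  of_hasFDerivAt (hasFDerivAt_const c p)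

theorem add (hf : HasPartialDerivAt f f' a p) (hg : HasPartialDerivAt g g' a p) :
    HasPartialDerivAt (fun q => f q + g q) (f' + g') a p :=
  (of_hasFDerivAt (hf.1.hasFDerivAt.add hg.1.hasFDerivAt)).congr_val
    (by rw [← hf.2, ← hg.2]; rfl)

theorem mul (hf : HasPartialDerivAt f f' a p) (hg : HasPartialDerivAt g g' a p) :
    HasPartialDerivAt (fun q => f q * g q) (f' * g p + f p * g') a p :=
  (of_hasFDerivAt (hf.1.hasFDerivAt.mul hg.1.hasFDerivAt)).congr_val
    (by rw [← hf.2, ← hg.2]; simp [partialDeriv]; ring)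

theorem mul_const (hf : HasPartialDerivAt f f' a p) (c : ℝ) :
    HasPartialDerivAt (fun q => f q * c) (f' * c) a p :=
  (hf.mul (const c)).congr_val (by ring)

theorem sum {κ : Type*} {s : Finset κ} {f : κ → Cn n → ℝ} {f' : κ → ℝ}
    (h : ∀ i ∈ s, HasPartialDerivAt (f i) (f' i) a p) :
    HasPartialDerivAt (fun q => ∑ i ∈ s, f i q) (∑ i ∈ s, f' i) a p :=
  (of_hasFDerivAt (HasFDerivAt.fun_sum fun i hi => (h i hi).1.hasFDerivAt)).congr_val (by
    rw [_root_.sum_apply]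
    exact Finset.sum_congr rfl fun i hi => (h i hi).2)

theorem realCoord (p : Cn n) (a b : Fin n ⊕ Fin n) :
    HasPartialDerivAt (fun q => realCoord q b) ((1 : Matrix (Fin n ⊕ Fin n) _ ℝ) b a) a p := by
  rcases b with i | i
  · refine (of_hasFDerivAt (L := Complex.reCLM ∘L
      ((EuclideanSpace.proj i : Cn n →L[ℂ] ℂ).restrictScalars ℝ))
      (ContinuousLinearMap.hasFDerivAt _)).congr_val ?_
    rcases a with j | j <;> simp [realFrame, Matrix.one_apply, apply_ite]
  · refine (of_hasFDerivAt (L := Complex.imCLM ∘L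
      ((EuclideanSpace.proj i : Cn n →L[ℂ] ℂ).restrictScalars ℝ))
      (ContinuousLinearMap.hasFDerivAt _)).congr_val ?_
    rcases a with j | j <;> simp [realFrame, Matrix.one_apply, apply_ite]

theorem rotCoord (p : Cn n) (a b : Fin n ⊕ Fin n) :
    HasPartialDerivAt (fun q => rotCoord q b) (Matrix.J (Fin n) ℝ b a) a p := by
  have h : (fun q : Cn n => HermitianKlsc.rotCoord q b)
      = fun q => ∑ c, HermitianKlsc.realCoord q c * Matrix.J (Fin n) ℝ b c := by
    funext q
    rw [← (isRotatedPair q).rot, mulVec, dotProduct]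
    exact Finset.sum_congr rfl fun c _ => mul_comm _ _
  rw [h]
  refine (sum fun c _ => (realCoord p a c).mul_const _).congr_val ?_
  simp [Matrix.one_apply]

theorem radial (p : Cn n) (a : Fin n ⊕ Fin n) :
    HasPartialDerivAt HermitianKlsc.radial (2 * HermitianKlsc.realCoord p a) a p := by
  have h : (HermitianKlsc.radial : Cn n → ℝ)
      = fun q => ∑ c, HermitianKlsc.realCoord q c * HermitianKlsc.realCoord q c := by
    funext q
    rw [← dotProduct_realCoord, dotProduct]
  rw [h]
  refine (sum fun c _ => (realCoord p a c).mul (realCoord p a c)).congr_val ?_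
  simp [Matrix.one_apply, Finset.sum_add_distrib]
  ring

theorem comp_radial {F : ℝ → ℝ} {F' : ℝ}
    (hF : HasDerivAt F F' (HermitianKlsc.radial p)) :
    HasPartialDerivAt (fun q => F (HermitianKlsc.radial q))
      (2 * HermitianKlsc.realCoord p a * F') a p := by
  have h := hF.hasFDerivAt.comp p (radial p a).1.hasFDerivAt
  refine (of_hasFDerivAt h).congr_val ?_
  have := (radial p a).2
  simp only [partialDeriv] at this
  simp [this]

end HasPartialDerivAt

theorem continuous_radial : Continuous (radial : Cn n → ℝ) := by
  unfold radial
  fun_prop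

theorem eventually_radial_mem {I : Set ℝ} (hI : IsOpen I) {p : Cn n} (hp : radial p ∈ I) :
    ∀ᶠ q in nhds p, radial q ∈ I :=
  continuous_radial.continuousAt.eventually (hI.mem_nhds hp)

end RealCalculus

/-! ### The Ricci tensor of a radial connection -/

section RadialCurvature

open Matrix

variable {n : ℕ}

/-- The partial derivatives of a symbol with radial coefficients. The values `x`, `w`, `δ`, `J`
at the point are free variables with equations, which keeps the expression short. -/
theorem hasPartialDerivAt_radialSymbol {A B C D E F : ℝ → ℝ} {A₁ B₁ C₁ D₁ E₁ F₁ : ℝ} {p : Cn n}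
    (hA : HasDerivAt A A₁ (radial p)) (hB : HasDerivAt B B₁ (radial p))
    (hC : HasDerivAt C C₁ (radial p)) (hD : HasDerivAt D D₁ (radial p))
    (hE : HasDerivAt E E₁ (radial p)) (hF : HasDerivAt F F₁ (radial p))
    (a d b c : Fin n ⊕ Fin n) {x w : Fin n ⊕ Fin n → ℝ}
    {δ J : Matrix (Fin n ⊕ Fin n) (Fin n ⊕ Fin n) ℝ}
    (hx : x = realCoord p) (hw : w = rotCoord p) (hδ : δ = 1) (hJ : J = Matrix.J (Fin n) ℝ) :
    HasPartialDerivAt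
      (fun q => radialSymbol (A (radial q)) (B (radial q)) (C (radial q)) (D (radial q))
        (E (radial q)) (F (radial q)) (realCoord q) (rotCoord q) (Matrix.J (Fin n) ℝ) d b c)
      (2 * x a * A₁ * (x b * δ d c + x c * δ d b)
        + A (radial p) * (δ b a * δ d c + δ c a * δ d b)
        + 2 * x a * B₁ * (x d * δ b c) + B (radial p) * (δ d a * δ b c)
        + 2 * x a * C₁ * (w c * J d b + w b * J d c)
        + C (radial p) * (J c a * J d b + J b a * J d c)
        + 2 * x a * D₁ * (x d * x b * x c)
        + D (radial p) * (δ d a * x b * x c + x d * δ b a * x c + x d * x b * δ c a)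
        + 2 * x a * E₁ * (x d * w b * w c)
        + E (radial p) * (δ d a * w b * w c + x d * J b a * w c + x d * w b * J c a)
        + 2 * x a * F₁ * (w d * (x b * w c + w b * x c))
        + F (radial p) * (J d a * (x b * w c + w b * x c)
          + w d * (δ b a * w c + x b * J c a + J b a * x c + w b * δ c a))) a p := by
  subst hx hw hδ hJ
  have X := HasPartialDerivAt.realCoord p a
  have W := HasPartialDerivAt.rotCoord p a
  have R : ∀ {G : ℝ → ℝ} {G' : ℝ}, HasDerivAt G G' (radial p) → HasPartialDerivAt _ _ a p :=
    fun h => HasPartialDerivAt.comp_radial h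
  unfold radialSymbol
  refine (((((((R hA).mul (((X b).mul_const _).add ((X c).mul_const _))).add
    ((R hB).mul ((X d).mul_const _))).add
    ((R hC).mul (((W c).mul_const _).add ((W b).mul_const _)))).add
    ((R hD).mul (((X d).mul (X b)).mul (X c)))).add
    ((R hE).mul (((X d).mul (W b)).mul (W c)))).add
    ((R hF).mul ((W d).mul (((X b).mul (W c)).add ((W b).mul (X c)))))).congr_val ?_
  ring

/-- The divergence `∂ₐΓᵃ_{bc}`. -/
theorem sum_partialDeriv_radialSymbol {A B C D E F : ℝ → ℝ} {A₁ B₁ C₁ D₁ E₁ F₁ t : ℝ} {p : Cn n}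
    (ht : radial p = t)
    (hA : HasDerivAt A A₁ t) (hB : HasDerivAt B B₁ t)
    (hC : HasDerivAt C C₁ t) (hD : HasDerivAt D D₁ t)
    (hE : HasDerivAt E E₁ t) (hF : HasDerivAt F F₁ t) (b c : Fin n ⊕ Fin n) :
    ∑ a, partialDeriv a
      (fun q => radialSymbol (A (radial q)) (B (radial q)) (C (radial q)) (D (radial q))
        (E (radial q)) (F (radial q)) (realCoord q) (rotCoord q) (Matrix.J (Fin n) ℝ) a b c) p
      = (2 * A t + 2 * t * B₁ + 2 * n * B t - 2 * C t) * (1 : Matrix (Fin n ⊕ Fin n) _ ℝ) b c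
        + (4 * A₁ + 2 * t * D₁ + (2 * n + 2) * D t - 2 * F t) * (realCoord p b * realCoord p c)
        + (-4 * C₁ + 2 * t * E₁ + (2 * n + 2) * E t + 2 * F t)
          * (rotCoord p b * rotCoord p c) := by
  subst ht
  have h := isRotatedPair p
  obtain ⟨x, hx⟩ : ∃ x, x = realCoord p := ⟨_, rfl⟩
  obtain ⟨w, hw⟩ : ∃ w, w = rotCoord p := ⟨_, rfl⟩
  obtain ⟨δ, hδ⟩ : ∃ δ : Matrix (Fin n ⊕ Fin n) (Fin n ⊕ Fin n) ℝ, δ = 1 := ⟨_, rfl⟩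
  obtain ⟨J, hJ⟩ : ∃ J, J = Matrix.J (Fin n) ℝ := ⟨_, rfl⟩
  have hxx : ∑ a, x a * x a = radial p := by rw [hx, ← dotProduct_realCoord p, dotProduct]
  have hxw : ∑ a, x a * w a = 0 := by
    have := h.dot_xw
    rwa [dotProduct, ← hx, ← hw] at this
  have hsum : ∀ (v : Fin n ⊕ Fin n → ℝ) c, ∑ a, v a * δ a c = v c := by
    intro v c; simp [hδ, Matrix.one_apply]
  have hsum' : ∀ (v : Fin n ⊕ Fin n → ℝ) c, ∑ a, v a * δ c a = v c := by
    intro v c; simp [hδ, Matrix.one_apply]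
  have hJx : ∀ c, ∑ a, x a * J c a = w c := by
    intro c
    rw [hx, hw, hJ, ← h.rot, mulVec, dotProduct]
    exact Finset.sum_congr rfl fun a _ => mul_comm _ _
  have hxJ : ∀ c, ∑ a, x a * J a c = -w c := by
    intro c
    have := congrFun (h.vecMul (realCoord p)) c
    rw [h.rot] at this
    rw [hx, hw, hJ, ← Pi.neg_apply, ← this, vecMul, dotProduct]
  have hJw : ∀ c, ∑ a, w a * J c a = -x c := by
    intro c
    rw [hx, hw, hJ, ← Pi.neg_apply, ← h.rot', mulVec, dotProduct]
    exact Finset.sum_congr rfl fun a _ => mul_comm _ _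
  have hJJ : ∀ b c, ∑ a, J b a * J a c = -δ b c := by
    intro b c
    rw [hJ, hδ, ← Matrix.neg_apply, ← h.sq, Matrix.mul_apply]
  have hJaa : ∀ a, J a a = 0 := by
    intro a; rw [hJ]; rcases a with i | i <;> simp [Matrix.J]
  have hδaa : ∀ a, δ a a = 1 := by
    intro a; rw [hδ]; simp
  have hδc : δ c b = δ b c := by simp only [hδ, Matrix.one_apply, eq_comm]
  have hcard : ∑ _a : Fin n ⊕ Fin n, (1 : ℝ) = 2 * n := by
    rw [← card_frame]; simp
  have key : ∀ a, _ := fun a =>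
    (hasPartialDerivAt_radialSymbol hA hB hC hD hE hF a a b c hx hw hδ hJ).eq
  rw [Finset.sum_congr rfl fun a _ => key a]
  rw [← hx, ← hw, ← hδ]
  calc _ = ∑ a, ((2 * A₁ * x b) * (x a * δ a c) + (2 * A₁ * x c) * (x a * δ a b)
        + A (radial p) * (δ b a * δ a c) + A (radial p) * (δ c a * δ a b)
        + (2 * B₁ * δ b c + 2 * D₁ * (x b * x c) + 2 * E₁ * (w b * w c)) * (x a * x a)
        + (B (radial p) * δ b c + D (radial p) * (x b * x c) + E (radial p) * (w b * w c)) * 1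
        + (2 * C₁ * w c) * (x a * J a b) + (2 * C₁ * w b) * (x a * J a c)
        + C (radial p) * (J c a * J a b) + C (radial p) * (J b a * J a c)
        + (D (radial p) * x c) * (x a * δ b a) + (D (radial p) * x b) * (x a * δ c a)
        + (E (radial p) * w c) * (x a * J b a) + (E (radial p) * w b) * (x a * J c a)
        + (2 * F₁ * (x b * w c + w b * x c)) * (x a * w a)
        + (F (radial p) * w c) * (w a * δ b a) + (F (radial p) * w b) * (w a * δ c a)
        + (F (radial p) * x b) * (w a * J c a) + (F (radial p) * x c) * (w a * J b a)) := by
        refine Finset.sum_congr rfl fun a _ => ?_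
        rw [hJaa, hδaa]
        ring
    _ = _ := by
        simp only [Finset.sum_add_distrib, ← Finset.mul_sum, hxx, hxw, hsum, hsum', hJx, hxJ, hJw,
          hJJ, hcard, hδc]
        ring

/-- The term `∂_bΓᵃ_{ac}`, computed from `Γᵃ_{ac} = T(𝐳) x_c`. -/
theorem sum_partialDeriv_radialSymbol_diag {A B C D E F : ℝ → ℝ} {A₁ B₁ C₁ D₁ E₁ F₁ t : ℝ}
    {p : Cn n} (ht : radial p = t)
    (hA : HasDerivAt A A₁ t) (hB : HasDerivAt B B₁ t)
    (hC : HasDerivAt C C₁ t) (hD : HasDerivAt D D₁ t)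
    (hE : HasDerivAt E E₁ t) (hF : HasDerivAt F F₁ t) (b c : Fin n ⊕ Fin n) :
    ∑ a, partialDeriv b
      (fun q => radialSymbol (A (radial q)) (B (radial q)) (C (radial q)) (D (radial q))
        (E (radial q)) (F (radial q)) (realCoord q) (rotCoord q) (Matrix.J (Fin n) ℝ) a a c) p
      = ((2 * n + 1) * A t + B t + C t + (D t + F t) * t) * (1 : Matrix (Fin n ⊕ Fin n) _ ℝ) b c
        + 2 * ((2 * n + 1) * A₁ + B₁ + C₁ + (D₁ + F₁) * t + (D t + F t))
          * (realCoord p b * realCoord p c) := by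
  subst ht
  have h1 := HasPartialDerivAt.sum (s := Finset.univ) fun a _ =>
    hasPartialDerivAt_radialSymbol hA hB hC hD hE hF b a a c rfl rfl rfl rfl
  have h2 : (fun q : Cn n => ∑ a, radialSymbol (A (radial q)) (B (radial q)) (C (radial q))
      (D (radial q)) (E (radial q)) (F (radial q)) (realCoord q) (rotCoord q)
      (Matrix.J (Fin n) ℝ) a a c)
      = fun q => ((2 * n + 1) * A (radial q) + B (radial q) + C (radial q)
        + (D (radial q) + F (radial q)) * radial q) * realCoord q c := by
    funext q
    exact sum_radialSymbol_diag (isRotatedPair q) _ _ _ _ _ _ c (dotProduct_realCoord q)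
      (card_frame n)
  rw [h2] at h1
  have h3 : HasDerivAt (fun s => (2 * n + 1) * A s + B s + C s + (D s + F s) * s)
      ((2 * n + 1) * A₁ + B₁ + C₁ + ((D₁ + F₁) * radial p + (D (radial p) + F (radial p)) * 1))
      (radial p) :=
    (((hA.const_mul _).add hB).add hC).add ((hD.add hF).mul (hasDerivAt_id _))
  have h4 := (HasPartialDerivAt.comp_radial (a := b) h3).mul (HasPartialDerivAt.realCoord p b c)
  calc _ = _ := Finset.sum_congr rfl fun a _ =>
        (hasPartialDerivAt_radialSymbol hA hB hC hD hE hF b a a c rfl rfl rfl rfl).eq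
    _ = _ := h1.eq.symm
    _ = _ := h4.eq
    _ = _ := by
      have : (1 : Matrix (Fin n ⊕ Fin n) _ ℝ) b c = (1 : Matrix (Fin n ⊕ Fin n) _ ℝ) c b := by
        simp only [Matrix.one_apply, eq_comm]
      rw [this]
      ring

/-- The Ricci tensor `∂ₐΓᵃ_{bc} - ∂_bΓᵃ_{ac} + Γᵃ_{ae}Γᵉ_{bc} - Γᵃ_{be}Γᵉ_{ac}` of a connection with
radial symbol. Here `T` is the coefficient in `Γᵃ_{ac} = T x_c`, and `T₁` is its derivative with
respect to `t`. -/
theorem ricci_of_christoffel {g : BilinField n} {A B C D E F : ℝ → ℝ}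
    {A₁ B₁ C₁ D₁ E₁ F₁ t : ℝ} {p : Cn n} (ht : radial p = t)
    (hΓ : ∀ᶠ q in nhds p, ∀ d b c, christoffel g d b c q
      = radialSymbol (A (radial q)) (B (radial q)) (C (radial q)) (D (radial q))
        (E (radial q)) (F (radial q)) (realCoord q) (rotCoord q) (Matrix.J (Fin n) ℝ) d b c)
    (hA : HasDerivAt A A₁ t) (hB : HasDerivAt B B₁ t)
    (hC : HasDerivAt C C₁ t) (hD : HasDerivAt D D₁ t)
    (hE : HasDerivAt E E₁ t) (hF : HasDerivAt F F₁ t) (b c : Fin n ⊕ Fin n)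
    {T T₁ : ℝ} (hT : T = (2 * n + 1) * A t + B t + C t + (D t + F t) * t)
    (hT₁ : T₁ = (2 * n + 1) * A₁ + B₁ + C₁ + (D₁ + F₁) * t + (D t + F t)) :
    ricci g b c p
      = (2 * A t + 2 * t * B₁ + 2 * n * B t - 2 * C t - T + T * B t * t - 2 * A t * B t * t)
          * (1 : Matrix (Fin n ⊕ Fin n) _ ℝ) b c
        + (4 * A₁ + 2 * t * D₁ + (2 * n + 2) * D t - 2 * F t - 2 * T₁ + T * (2 * A t + D t * t)
            - ((2 * n - 2) * A t ^ 2 + (2 * A t + B t + D t * t) ^ 2 + (A t + C t + F t * t) ^ 2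
              - 2 * A t * B t)) * (realCoord p b * realCoord p c)
        + (-4 * C₁ + 2 * t * E₁ + (2 * n + 2) * E t + 2 * F t + T * (-2 * C t + E t * t)
            - (2 * (A t + F t * t) * (B t - C t + E t * t) - 2 * n * C t ^ 2
              + 2 * C t * ((B t - C t + E t * t) - (A t + F t * t)) - 2 * A t * B t))
          * (rotCoord p b * rotCoord p c) := by
  have hpd : ∀ a d b c, partialDeriv a (christoffel g d b c) p = partialDeriv a
      (fun q => radialSymbol (A (radial q)) (B (radial q)) (C (radial q)) (D (radial q))
        (E (radial q)) (F (radial q)) (realCoord q) (rotCoord q) (Matrix.J (Fin n) ℝ) d b c) p := by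
    intro a d b c
    have : christoffel g d b c =ᶠ[nhds p] _ := hΓ.mono fun q hq => hq d b c
    rw [partialDeriv, partialDeriv, this.fderiv_eq]
  have hΓp := hΓ.self_of_nhds
  have ht' : realCoord p ⬝ᵥ realCoord p = t := by rw [dotProduct_realCoord, ht]
  have hr := isRotatedPair p
  simp only [ricci, riemann, hpd, hΓp, Finset.sum_add_distrib, Finset.sum_sub_distrib]
  rw [sum_partialDeriv_radialSymbol ht hA hB hC hD hE hF,
    sum_partialDeriv_radialSymbol_diag ht hA hB hC hD hE hF, ht,
    sum_radialSymbol_mul hr _ _ _ _ _ _ b c ht' (card_frame n), Finset.sum_comm]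
  simp only [← Finset.sum_mul, sum_radialSymbol_diag hr _ _ _ _ _ _ _ ht' (card_frame n),
    mul_assoc _ (realCoord p _) (radialSymbol _ _ _ _ _ _ _ _ _ _ _ _), ← Finset.mul_sum,
    sum_mul_radialSymbol hr _ _ _ _ _ _ b c ht']
  subst hT hT₁
  ring

end RadialCurvature

/-! ### The Riemannian scalar curvature of a radial metric -/

section RadialMetric

open Matrix

variable {n : ℕ}

/-- Where `𝐳 ∈ I`, the metric is `a(𝐳) ⟨·,·⟩ + b(𝐳) (x ⊗ x + Jx ⊗ Jx)` in the real frame. -/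
def HasRadialGram (g : BilinField n) (a b : ℝ → ℝ) (I : Set ℝ) : Prop :=
  ∀ q, radial q ∈ I →
    gramMatrix g q = radialGram (a (radial q)) (b (radial q)) (realCoord q) (rotCoord q)

theorem partialDeriv_gramMatrix {g : BilinField n} {a b : ℝ → ℝ} {I : Set ℝ} (hI : IsOpen I)
    (hg : HasRadialGram g a b I) {p : Cn n} (hp : radial p ∈ I) {a₁ b₁ : ℝ}
    (ha : HasDerivAt a a₁ (radial p)) (hb : HasDerivAt b b₁ (radial p))
    (i j k : Fin n ⊕ Fin n) :
    partialDeriv k (fun q => gramMatrix g q i j) p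
      = 2 * realCoord p k * radialGram a₁ b₁ (realCoord p) (rotCoord p) i j
        + b (radial p) * ((1 : Matrix (Fin n ⊕ Fin n) _ ℝ) i k * realCoord p j
          + realCoord p i * (1 : Matrix (Fin n ⊕ Fin n) _ ℝ) j k
          + Matrix.J (Fin n) ℝ i k * rotCoord p j + rotCoord p i * Matrix.J (Fin n) ℝ j k) := by
  have hev : (fun q => gramMatrix g q i j) =ᶠ[nhds p] fun q =>
      a (radial q) * (1 : Matrix (Fin n ⊕ Fin n) _ ℝ) i j
        + b (radial q) * (realCoord q i * realCoord q j + rotCoord q i * rotCoord q j) := by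
    filter_upwards [eventually_radial_mem hI hp] with q hq
    rw [hg q hq, radialGram_apply]
  have X := HasPartialDerivAt.realCoord p k
  have W := HasPartialDerivAt.rotCoord p k
  have h := (((HasPartialDerivAt.comp_radial (a := k) ha).mul_const
    ((1 : Matrix (Fin n ⊕ Fin n) _ ℝ) i j)).add ((HasPartialDerivAt.comp_radial (a := k) hb).mul
    (((X i).mul (X j)).add ((W i).mul (W j))))).congr_of_eventuallyEq hev
  rw [h.eq, radialGram_apply]
  ring

theorem christoffel_of_radialGram {g : BilinField n} {a b : ℝ → ℝ} {I : Set ℝ} (hI : IsOpen I)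
    (hg : HasRadialGram g a b I) {p : Cn n} {t : ℝ} (ht : radial p = t) (hp : t ∈ I) {a₁ b₁ s : ℝ}
    (ha : HasDerivAt a a₁ t) (hb : HasDerivAt b b₁ t)
    (ha0 : a t ≠ 0) (hs : a t + t * b t = s) (hs0 : s ≠ 0) (d i j : Fin n ⊕ Fin n) :
    christoffel g d i j p
      = radialSymbol (a₁ / a t) ((b t - a₁) / s) (b t / a t)
        (2 * ((b₁ * a t - b t * a₁) / (a t * s)) - b₁ / s)
        (2 * b t ^ 2 / (a t * s) - b₁ / s)
        ((b₁ * a t - b t * a₁) / (a t * s) - b t ^ 2 / (a t * s))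
        (realCoord p) (rotCoord p) (Matrix.J (Fin n) ℝ) d i j := by
  subst ht
  have hr := isRotatedPair p
  have ht' := dotProduct_realCoord p
  have hG := hg p hp
  have hdet : (radialGram (a (radial p)) (b (radial p)) (realCoord p) (rotCoord p))⁻¹
      * radialGram (a (radial p)) (b (radial p)) (realCoord p) (rotCoord p) = 1 := by
    rw [radialGram_inv hr ht' ha0 hs hs0]
    exact mul_eq_one_comm.mp (radialGram_mul_inv hr ht' ha0 hs hs0)
  have key := radialGram_mulVec_symbolMatrix hr a₁ b₁ ht' ha0 hs hs0 (Pi.single i 1)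
    (Pi.single j 1)
  apply_fun fun y => (radialGram (a (radial p)) (b (radial p)) (realCoord p) (rotCoord p))⁻¹ *ᵥ y
    at key
  rw [mulVec_mulVec, hdet, one_mulVec] at key
  have key' := congrFun key d
  rw [mulVec_single_one, Matrix.col_apply, ← radialSymbol_eq_symbolMatrix] at key'
  rw [key', christoffel, hG, mulVec, dotProduct, Finset.mul_sum]
  refine Finset.sum_congr rfl fun e _ => ?_
  simp only [partialDeriv_gramMatrix hI hg hp ha hb]
  simp only [Pi.add_apply, Pi.sub_apply, Pi.smul_apply, smul_eq_mul, dotProduct_single_one,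
    mulVec_single_one, Matrix.col_apply, single_one_dotProduct]
  have hJ : Matrix.J (Fin n) ℝ i j = -Matrix.J (Fin n) ℝ j i := by
    rw [← Matrix.neg_apply, ← Matrix.J_transpose, Matrix.transpose_apply]
  have hJ2 : ∀ k, Matrix.J (Fin n) ℝ k e = -Matrix.J (Fin n) ℝ e k := by
    intro k
    rw [← Matrix.neg_apply, ← Matrix.J_transpose, Matrix.transpose_apply]
  have hδ : ∀ i j, (1 : Matrix (Fin n ⊕ Fin n) _ ℝ) i j = (1 : Matrix (Fin n ⊕ Fin n) _ ℝ) j i := by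
    intro i j; simp only [Matrix.one_apply, eq_comm]
  have hs1 : (Pi.single i 1 : Fin n ⊕ Fin n → ℝ) j = (1 : Matrix (Fin n ⊕ Fin n) _ ℝ) j i := by
    simp [Matrix.one_apply, Pi.single_apply]
  simp only [radialGram_apply, hs1, hδ i j, hδ i e, hδ j e, hJ, hJ2]
  ring

theorem scalarCurvature_of_christoffel {g : BilinField n} {A B C D E F : ℝ → ℝ}
    {A₁ B₁ C₁ D₁ E₁ F₁ a b s t : ℝ} {p : Cn n} (ht : radial p = t)
    (hg : gramMatrix g p = radialGram a b (realCoord p) (rotCoord p))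
    (ha0 : a ≠ 0) (hs : a + t * b = s) (hs0 : s ≠ 0)
    (hΓ : ∀ᶠ q in nhds p, ∀ d b c, christoffel g d b c q
      = radialSymbol (A (radial q)) (B (radial q)) (C (radial q)) (D (radial q))
        (E (radial q)) (F (radial q)) (realCoord q) (rotCoord q) (Matrix.J (Fin n) ℝ) d b c)
    (hA : HasDerivAt A A₁ t) (hB : HasDerivAt B B₁ t)
    (hC : HasDerivAt C C₁ t) (hD : HasDerivAt D D₁ t)
    (hE : HasDerivAt E E₁ t) (hF : HasDerivAt F F₁ t)
    {T T₁ : ℝ} (hT : T = (2 * n + 1) * A t + B t + C t + (D t + F t) * t)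
    (hT₁ : T₁ = (2 * n + 1) * A₁ + B₁ + C₁ + (D₁ + F₁) * t + (D t + F t)) :
    scalarCurvature g p
      = (2 * n - 2) * (2 * A t + 2 * t * B₁ + 2 * n * B t - 2 * C t - T + T * B t * t
            - 2 * A t * B t * t) / a
        + (2 * (2 * A t + 2 * t * B₁ + 2 * n * B t - 2 * C t - T + T * B t * t
            - 2 * A t * B t * t)
          + ((4 * A₁ + 2 * t * D₁ + (2 * n + 2) * D t - 2 * F t - 2 * T₁
              + T * (2 * A t + D t * t)
              - ((2 * n - 2) * A t ^ 2 + (2 * A t + B t + D t * t) ^ 2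
                + (A t + C t + F t * t) ^ 2 - 2 * A t * B t))
            + (-4 * C₁ + 2 * t * E₁ + (2 * n + 2) * E t + 2 * F t + T * (-2 * C t + E t * t)
              - (2 * (A t + F t * t) * (B t - C t + E t * t) - 2 * n * C t ^ 2
                + 2 * C t * ((B t - C t + E t * t) - (A t + F t * t)) - 2 * A t * B t))) * t)
          / s := by
  have hric := fun i j => ricci_of_christoffel ht hΓ hA hB hC hD hE hF i j hT hT₁
  subst ht
  simp only [scalarCurvature, hric, hg]
  exact sum_radialGram_mul (isRotatedPair p) (dotProduct_realCoord p) (card_frame n)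
    ha0 hs hs0 _ _ _

/-- For `a = 2 k f` and `b = 2 k f₁` the factor `k` enters the Christoffel symbols only through its
logarithmic derivative `l`. -/
theorem christoffel_of_conformal {g : BilinField n} {k l f f₁ f₂ : ℝ → ℝ} {I : Set ℝ}
    (hI : IsOpen I) (hg : HasRadialGram g (fun r => 2 * k r * f r) (fun r => 2 * k r * f₁ r) I)
    {p : Cn n} {t : ℝ} (ht : radial p = t) (hp : t ∈ I)
    (hk : HasDerivAt k (k t * l t) t) (hf : HasDerivAt f (f₁ t) t) (hf₁ : HasDerivAt f₁ (f₂ t) t)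
    (hk0 : k t ≠ 0) (hf0 : f t ≠ 0) (hs0 : f t + t * f₁ t ≠ 0) (d i j : Fin n ⊕ Fin n) :
    christoffel g d i j p
      = radialSymbol (l t + f₁ t / f t) (-(l t * f t / (f t + t * f₁ t))) (f₁ t / f t)
        ((f₂ t - 2 * f₁ t ^ 2 / f t - l t * f₁ t) / (f t + t * f₁ t))
        ((2 * f₁ t ^ 2 / f t - l t * f₁ t - f₂ t) / (f t + t * f₁ t))
        ((f₂ t - 2 * f₁ t ^ 2 / f t) / (f t + t * f₁ t))
        (realCoord p) (rotCoord p) (Matrix.J (Fin n) ℝ) d i j := by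
  have hs : 2 * k t * f t + t * (2 * k t * f₁ t) = 2 * k t * (f t + t * f₁ t) := by ring
  rw [christoffel_of_radialGram hI hg ht hp ((hk.const_mul 2).mul hf) ((hk.const_mul 2).mul hf₁)
    (by simp [hk0, hf0]) hs (by simp [hk0, hs0])]
  obtain ⟨s, hs'⟩ : ∃ s, s = f t + t * f₁ t := ⟨_, rfl⟩
  rw [← hs'] at hs0 ⊢
  congr 1 <;> field_simp <;> ring

/-- The scalar curvature of a metric conformal, with factor `k(𝐳)`, to the one with potential
`φ(𝐳)`, where `f = φ'`, `f₁`, `f₂`, `f₃` are the further derivatives, `l = (log k)'`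
and `s = f + t f₁`. The first summand is twice the Chern scalar curvature. -/
theorem scalarCurvature_of_conformal {g : BilinField n} {k l f f₁ f₂ : ℝ → ℝ} {I : Set ℝ}
    (hI : IsOpen I) (hg : HasRadialGram g (fun r => 2 * k r * f r) (fun r => 2 * k r * f₁ r) I)
    {p : Cn n} {t l₁ f₃ s : ℝ} (ht : radial p = t) (hp : t ∈ I)
    (hk : ∀ r ∈ I, HasDerivAt k (k r * l r) r) (hl : HasDerivAt l l₁ t)
    (hf : ∀ r ∈ I, HasDerivAt f (f₁ r) r) (hf₁ : ∀ r ∈ I, HasDerivAt f₁ (f₂ r) r)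
    (hf₂ : HasDerivAt f₂ f₃ t) (hk0 : ∀ r ∈ I, k r ≠ 0) (hf0 : ∀ r ∈ I, f r ≠ 0)
    (hs0 : ∀ r ∈ I, f r + r * f₁ r ≠ 0) (hs : f t + t * f₁ t = s) :
    scalarCurvature g p
      = -(2 / k t) * ((n - 1) * (n * l t + (n - 1) * (f₁ t / f t) + (2 * f₁ t + t * f₂ t) / s)
              / f t
            + ((n * l t + (n - 1) * (f₁ t / f t) + (2 * f₁ t + t * f₂ t) / s)
              + t * (n * l₁ + (n - 1) * ((f₂ t * f t - f₁ t * f₁ t) / f t ^ 2)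
                + ((3 * f₂ t + t * f₃) * s - (2 * f₁ t + t * f₂ t) * (2 * f₁ t + t * f₂ t))
                  / s ^ 2)) / s)
        - (2 * n - 2) / k t * ((n - 1) * l t / f t
            + (l t + t * l₁ + (n - 1 / 2) * t * l t ^ 2) / s) := by
  have hs00 : s ≠ 0 := hs ▸ hs0 t hp
  have dS : HasDerivAt (fun r => f r + r * f₁ r) (2 * f₁ t + t * f₂ t) t :=
    ((hf t hp).add ((hasDerivAt_id t).mul (hf₁ t hp))).congr_deriv (by simp; ring)
  have dC : HasDerivAt (fun r => f₁ r / f r) ((f₂ t * f t - f₁ t * f₁ t) / f t ^ 2) t :=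
    (hf₁ t hp).div (hf t hp) (hf0 t hp)
  have dA := hl.add dC
  have dB := ((hl.mul (hf t hp)).div dS (hs0 t hp)).neg
  have dQ : HasDerivAt (fun r => 2 * f₁ r ^ 2 / f r)
      ((4 * f₁ t * f₂ t * f t - 2 * f₁ t ^ 2 * f₁ t) / f t ^ 2) t :=
    ((((hf₁ t hp).pow 2).const_mul 2).div (hf t hp) (hf0 t hp)).congr_deriv (by simp; ring)
  have dL := hl.mul (hf₁ t hp)
  have dD := ((hf₂.sub dQ).sub dL).div dS (hs0 t hp)
  have dE := ((dQ.sub dL).sub hf₂).div dS (hs0 t hp)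
  have dF := (hf₂.sub dQ).div dS (hs0 t hp)
  have hst : 2 * k t * f t + t * (2 * k t * f₁ t) = 2 * k t * s := by rw [← hs]; ring
  have hk00 := hk0 t hp
  have hf00 := hf0 t hp
  rw [scalarCurvature_of_christoffel ht ((hg p (ht ▸ hp)).trans (by rw [ht]))
    (by simp [hk00, hf00]) hst (by simp [hk00, hs00]) (by
      filter_upwards [eventually_radial_mem hI (ht ▸ hp)] with q hq d i j
      exact christoffel_of_conformal hI hg rfl hq (hk _ hq) (hf _ hq) (hf₁ _ hq) (hk0 _ hq)
        (hf0 _ hq) (hs0 _ hq) d i j) dA dB dC dD dE dF rfl rfl]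
  simp only [Pi.sub_apply, Pi.mul_apply, Pi.add_apply, Pi.div_apply, Pi.neg_apply, hs]
  generalize k t = K at *
  generalize l t = l at *
  generalize f t = F at *
  generalize f₁ t = F1 at *
  generalize f₂ t = F2 at *
  clear dS dC dA dB dQ dL dD dE dF
  field_simp
  subst hs
  ring

end RadialMetric

/-! ### Wirtinger derivatives and the Chern scalar curvature of a radial metric -/

section ChernCurvature

open Matrix ComplexConjugate

variable {n : ℕ}

/-- `f` is real differentiable at `p`, with `∂f/∂zᵢ = f'` and `∂f/∂z̄ᵢ = f''`. -/
structure HasWirtingerAt (f : Cn n → ℂ) (f' f'' : ℂ) (i : Fin n) (p : Cn n) : Prop where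
  differentiableAt : DifferentiableAt ℝ f p
  dz_eq : dz i f p = f'
  dzbar_eq : dzbar i f p = f''

namespace HasWirtingerAt

variable {f g : Cn n → ℂ} {f' f'' g' g'' : ℂ} {i : Fin n} {p : Cn n}

theorem of_hasFDerivAt {L : Cn n →L[ℝ] ℂ} (h : HasFDerivAt f L p) :
    HasWirtingerAt f
      (1 / 2 * (L (realFrame (Sum.inl i)) - Complex.I * L (realFrame (Sum.inr i))))
      (1 / 2 * (L (realFrame (Sum.inl i)) + Complex.I * L (realFrame (Sum.inr i)))) i p :=
  ⟨h.differentiableAt, by rw [dz, h.fderiv], by rw [dzbar, h.fderiv]⟩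

theorem congr_val {e' e'' : ℂ} (h : HasWirtingerAt f f' f'' i p) (h' : f' = e') (h'' : f'' = e'') :
    HasWirtingerAt f e' e'' i p := h' ▸ h'' ▸ h

theorem congr_of_eventuallyEq (h : HasWirtingerAt f f' f'' i p) (e : g =ᶠ[nhds p] f) :
    HasWirtingerAt g f' f'' i p :=
  ⟨h.differentiableAt.congr_of_eventuallyEq e,
    by rw [dz, e.fderiv_eq]; exact h.dz_eq, by rw [dzbar, e.fderiv_eq]; exact h.dzbar_eq⟩

theorem const (c : ℂ) : HasWirtingerAt (fun _ => c) 0 0 i p :=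
  (of_hasFDerivAt (hasFDerivAt_const c p)).congr_val (by simp) (by simp)

theorem add (hf : HasWirtingerAt f f' f'' i p) (hg : HasWirtingerAt g g' g'' i p) :
    HasWirtingerAt (fun q => f q + g q) (f' + g') (f'' + g'') i p :=
  (of_hasFDerivAt (hf.1.hasFDerivAt.add hg.1.hasFDerivAt)).congr_val
    (by rw [← hf.2, ← hg.2]; simp [dz]; ring) (by rw [← hf.3, ← hg.3]; simp [dzbar]; ring)

theorem mul (hf : HasWirtingerAt f f' f'' i p) (hg : HasWirtingerAt g g' g'' i p) :
    HasWirtingerAt (fun q => f q * g q) (f' * g p + f p * g') (f'' * g p + f p * g'') i p :=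
  (of_hasFDerivAt (hf.1.hasFDerivAt.mul hg.1.hasFDerivAt)).congr_val
    (by rw [← hf.2, ← hg.2]; simp [dz]; ring) (by rw [← hf.3, ← hg.3]; simp [dzbar]; ring)

theorem sum {κ : Type*} {s : Finset κ} {f : κ → Cn n → ℂ} {f' f'' : κ → ℂ}
    (h : ∀ k ∈ s, HasWirtingerAt (f k) (f' k) (f'' k) i p) :
    HasWirtingerAt (fun q => ∑ k ∈ s, f k q) (∑ k ∈ s, f' k) (∑ k ∈ s, f'' k) i p := by
  refine (of_hasFDerivAt (HasFDerivAt.fun_sum fun k hk => (h k hk).1.hasFDerivAt)).congr_val ?_ ?_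
  · simp only [_root_.sum_apply, Finset.mul_sum, ← Finset.sum_sub_distrib]
    exact Finset.sum_congr rfl fun k hk => (h k hk).2
  · simp only [_root_.sum_apply, Finset.mul_sum, ← Finset.sum_add_distrib]
    exact Finset.sum_congr rfl fun k hk => (h k hk).3

theorem coord (p : Cn n) (i j : Fin n) :
    HasWirtingerAt (fun q => q j) ((1 : Matrix (Fin n) (Fin n) ℂ) i j) 0 i p := by
  refine (of_hasFDerivAt (L := (EuclideanSpace.proj j : Cn n →L[ℂ] ℂ).restrictScalars ℝ)
    (ContinuousLinearMap.hasFDerivAt _)).congr_val ?_ ?_ <;>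
  · by_cases h : i = j
    · subst h
      simp [realFrame] <;> norm_num
    · simp [realFrame, h, Ne.symm h]

theorem conj_coord (p : Cn n) (i j : Fin n) :
    HasWirtingerAt (fun q => conj (q j)) 0 ((1 : Matrix (Fin n) (Fin n) ℂ) i j) i p := by
  refine (of_hasFDerivAt (L := (Complex.conjCLE : ℂ →L[ℝ] ℂ) ∘L
    (EuclideanSpace.proj j : Cn n →L[ℂ] ℂ).restrictScalars ℝ)
    (ContinuousLinearMap.hasFDerivAt _)).congr_val ?_ ?_ <;>
  · by_cases h : i = j
    · subst h
      simp [realFrame] <;> norm_num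
    · simp [realFrame, h, Ne.symm h]

theorem comp_radial {F : ℝ → ℝ} {F' : ℝ} (hF : HasDerivAt F F' (HermitianKlsc.radial p)) :
    HasWirtingerAt (fun q => (F (HermitianKlsc.radial q) : ℂ)) (F' * conj (p i)) (F' * p i)
      i p := by
  obtain ⟨L, h⟩ : ∃ L : Cn n →L[ℝ] ℝ,
      HasFDerivAt (fun q : Cn n => F (HermitianKlsc.radial q)) L p :=
    ⟨_, hF.hasFDerivAt.comp p (HasPartialDerivAt.radial p (Sum.inl i)).1.hasFDerivAt⟩
  have h1 := (HasPartialDerivAt.comp_radial (a := Sum.inl i) hF).2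
  have h2 := (HasPartialDerivAt.comp_radial (a := Sum.inr i) hF).2
  simp only [partialDeriv, h.fderiv] at h1 h2
  refine (of_hasFDerivAt (Complex.ofRealCLM.hasFDerivAt.comp p h)).congr_val ?_ ?_
  · rw [ContinuousLinearMap.comp_apply, ContinuousLinearMap.comp_apply, h1, h2]
    apply Complex.ext <;> simp [realCoord] <;> ring
  · rw [ContinuousLinearMap.comp_apply, ContinuousLinearMap.comp_apply, h1, h2]
    apply Complex.ext <;> simp [realCoord] <;> ring

end HasWirtingerAt

/-- The vector of the conjugate coordinates `z̄ᵢ`. -/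
def conjCoord (p : Cn n) (i : Fin n) : ℂ := conj (p i)

theorem dotProduct_conjCoord (p : Cn n) : (fun i => p i) ⬝ᵥ conjCoord p = (radial p : ℂ) := by
  simp [dotProduct, conjCoord, radial, Complex.mul_conj, Complex.normSq_eq_norm_sq]

/-- The Hermitian matrix with entries `a δᵢⱼ + b z̄ᵢ zⱼ`. -/
def radialHerm (a b : ℂ) (p : Cn n) : Matrix (Fin n) (Fin n) ℂ :=
  a • 1 + b • vecMulVec (conjCoord p) (fun i => p i)

theorem radialHerm_apply (a b : ℂ) (p : Cn n) (i j : Fin n) :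
    radialHerm a b p i j = a * (1 : Matrix (Fin n) (Fin n) ℂ) i j + b * (conj (p i) * p j) := by
  simp [radialHerm, vecMulVec_apply, conjCoord]

theorem radialHerm_mul (a b a' b' : ℂ) (p : Cn n) :
    radialHerm a b p * radialHerm a' b' p
      = radialHerm (a * a') (a * b' + b * a' + b * b' * radial p) p := by
  simp only [radialHerm, Matrix.add_mul, Matrix.mul_add, Matrix.smul_mul, Matrix.mul_smul,
    Matrix.one_mul, Matrix.mul_one, vecMulVec_mul_vecMulVec, dotProduct_conjCoord]
  ext i j
  simp [vecMulVec_apply]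
  ring

theorem trace_radialHerm (a b : ℂ) (p : Cn n) :
    (radialHerm a b p).trace = n * a + b * radial p := by
  rw [radialHerm, trace_add, trace_smul, trace_smul, trace_one, trace_vecMulVec, dotProduct_comm,
    dotProduct_conjCoord]
  simp [mul_comm]

theorem radialHerm_mul_inv {a b s : ℂ} {p : Cn n} (ha : a ≠ 0) (hs : a + radial p * b = s)
    (hs0 : s ≠ 0) :
    radialHerm a b p * radialHerm (1 / a) (-(b / (a * s))) p = 1 := by
  rw [radialHerm_mul]
  have h1 : a * (1 / a) = 1 := by field_simp
  have h2 : a * -(b / (a * s)) + b * (1 / a) + b * -(b / (a * s)) * radial p = 0 := by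
    field_simp
    rw [← hs]
    ring
  rw [h1, h2, radialHerm]
  simp

theorem radialHerm_inv {a b s : ℂ} {p : Cn n} (ha : a ≠ 0) (hs : a + radial p * b = s)
    (hs0 : s ≠ 0) : (radialHerm a b p)⁻¹ = radialHerm (1 / a) (-(b / (a * s))) p :=
  Matrix.inv_eq_right_inv (radialHerm_mul_inv ha hs hs0)

theorem trace_radialHerm_inv_mul {a b s : ℂ} {p : Cn n} (ha : a ≠ 0) (hs : a + radial p * b = s)
    (hs0 : s ≠ 0) (c d : ℂ) :
    ((radialHerm a b p)⁻¹ * radialHerm c d p).trace = (n - 1) * c / a + (c + radial p * d) / s := by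
  rw [radialHerm_inv ha hs hs0, radialHerm_mul, trace_radialHerm]
  field_simp
  rw [← hs]
  ring

/-- Where `𝐳 ∈ I`, the metric has `g_{ij̄} = a(𝐳) δᵢⱼ + b(𝐳) z̄ᵢ zⱼ`. -/
def HasRadialHerm (g : BilinField n) (a b : ℝ → ℝ) (I : Set ℝ) : Prop :=
  ∀ q, radial q ∈ I → hermMatrix g q = radialHerm (a (radial q)) (b (radial q)) q

theorem hasWirtingerAt_hermMatrix {g : BilinField n} {a b : ℝ → ℝ} {I : Set ℝ} (hI : IsOpen I)
    (hg : HasRadialHerm g a b I) {p : Cn n} (hp : radial p ∈ I) {a₁ b₁ : ℝ}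
    (ha : HasDerivAt a a₁ (radial p)) (hb : HasDerivAt b b₁ (radial p)) (i k q : Fin n) :
    dz i (fun x => hermMatrix g x k q) p
      = conj (p i) * radialHerm a₁ b₁ p k q
        + b (radial p) * (conj (p k) * (1 : Matrix (Fin n) (Fin n) ℂ) i q) := by
  have hev : (fun x => hermMatrix g x k q) =ᶠ[nhds p] fun x =>
      (a (radial x) : ℂ) * (1 : Matrix (Fin n) (Fin n) ℂ) k q
        + b (radial x) * (conj (x k) * x q) := by
    filter_upwards [eventually_radial_mem hI hp] with x hx
    rw [hg x hx, radialHerm_apply]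
  have h := (((HasWirtingerAt.comp_radial (i := i) ha).mul (HasWirtingerAt.const
    ((1 : Matrix (Fin n) (Fin n) ℂ) k q))).add ((HasWirtingerAt.comp_radial (i := i) hb).mul
    ((HasWirtingerAt.conj_coord p i k).mul
      (HasWirtingerAt.coord p i q)))).congr_of_eventuallyEq hev
  rw [h.dz_eq, radialHerm_apply]
  ring

theorem chernConnection_of_radialHerm {g : BilinField n} {a b : ℝ → ℝ} {I : Set ℝ} (hI : IsOpen I)
    (hg : HasRadialHerm g a b I) {p : Cn n} (hp : radial p ∈ I) {a₁ b₁ : ℝ}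
    (ha : HasDerivAt a a₁ (radial p)) (hb : HasDerivAt b b₁ (radial p)) (p' i k : Fin n) :
    chernConnection g p' i k p
      = ∑ q, (radialHerm (a (radial p)) (b (radial p)) p)⁻¹ q p'
        * (conj (p i) * radialHerm a₁ b₁ p k q
          + b (radial p) * (conj (p k) * (1 : Matrix (Fin n) (Fin n) ℂ) i q)) := by
  simp only [chernConnection, hermInverse, hg p hp, hasWirtingerAt_hermMatrix hI hg hp ha hb]

/-- `∑ₖ Γᵏ_{ik} = ∂ᵢ log det (g)`. -/
theorem sum_chernConnection_of_radialHerm {g : BilinField n} {a b : ℝ → ℝ} {I : Set ℝ}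
    (hI : IsOpen I)
    (hg : HasRadialHerm g a b I) {p : Cn n} (hp : radial p ∈ I) {a₁ b₁ s : ℝ}
    (ha : HasDerivAt a a₁ (radial p)) (hb : HasDerivAt b b₁ (radial p))
    (ha0 : a (radial p) ≠ 0) (hs : a (radial p) + radial p * b (radial p) = s) (hs0 : s ≠ 0)
    (i : Fin n) :
    ∑ k, chernConnection g k i k p
      = (((n - 1) * a₁ / a (radial p) + (a₁ + b (radial p) + radial p * b₁) / s : ℝ) : ℂ)
        * conj (p i) := by
  have ha0' : (a (radial p) : ℂ) ≠ 0 := by exact_mod_cast ha0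
  have hs0' : (s : ℂ) ≠ 0 := by exact_mod_cast hs0
  have hs' : (a (radial p) : ℂ) + radial p * b (radial p) = s := by exact_mod_cast hs
  have h1 := trace_radialHerm_inv_mul ha0' hs' hs0' (p := p) a₁ b₁
  have h2 : ∑ k, (radialHerm (a (radial p)) (b (radial p)) p)⁻¹ i k * conj (p k)
      = conj (p i) / s := by
    rw [radialHerm_inv ha0' hs' hs0']
    have : ∑ k, radialHerm (1 / (a (radial p) : ℂ)) (-(b (radial p) / (a (radial p) * s))) p i k
        * conj (p k) = (radialHerm (1 / (a (radial p) : ℂ))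
          (-(b (radial p) / (a (radial p) * s))) p *ᵥ conjCoord p) i := rfl
    rw [this, radialHerm, add_mulVec, smul_mulVec, smul_mulVec, vecMulVec_mulVec, one_mulVec,
      dotProduct_conjCoord]
    simp [conjCoord]
    field_simp
    rw [← hs']
    ring
  simp only [chernConnection_of_radialHerm hI hg hp ha hb, mul_add, Finset.sum_add_distrib]
  have h3 : ∑ k, ∑ q, (radialHerm (a (radial p)) (b (radial p)) p)⁻¹ q k
      * (conj (p i) * radialHerm a₁ b₁ p k q)
      = conj (p i) * ((radialHerm (a (radial p)) (b (radial p)) p)⁻¹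
        * radialHerm a₁ b₁ p).trace := by
    rw [Finset.sum_comm, Matrix.trace, Finset.mul_sum]
    refine Finset.sum_congr rfl fun q _ => ?_
    rw [Matrix.diag, Matrix.mul_apply, Finset.mul_sum]
    refine Finset.sum_congr rfl fun k _ => ?_
    ring
  have h4 : ∑ k, ∑ q, (radialHerm (a (radial p)) (b (radial p)) p)⁻¹ q k
      * (b (radial p) * (conj (p k) * (1 : Matrix (Fin n) (Fin n) ℂ) i q))
      = b (radial p) * (conj (p i) / s) := by
    rw [← h2, Finset.mul_sum]
    refine Finset.sum_congr rfl fun k _ => ?_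
    simp [Matrix.one_apply]
    ring
  rw [h3, h4, h1]
  push_cast
  ring

theorem differentiableAt_chernConnection {g : BilinField n} {a b a₁ b₁ : ℝ → ℝ} {I : Set ℝ}
    (hI : IsOpen I) (hg : HasRadialHerm g a b I) {p : Cn n} (hp : radial p ∈ I)
    (ha : ∀ r ∈ I, HasDerivAt a (a₁ r) r) (hb : ∀ r ∈ I, HasDerivAt b (b₁ r) r)
    (ha₁ : DifferentiableAt ℝ a₁ (radial p)) (hb₁ : DifferentiableAt ℝ b₁ (radial p))
    (ha0 : ∀ r ∈ I, a r ≠ 0) (hs0 : ∀ r ∈ I, a r + r * b r ≠ 0) (p' i k : Fin n) :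
    DifferentiableAt ℝ (chernConnection g p' i k) p := by
  have hev : chernConnection g p' i k =ᶠ[nhds p] fun x =>
      ∑ q, (((1 / a (radial x) : ℝ) : ℂ) * (1 : Matrix (Fin n) (Fin n) ℂ) q p'
          + ((-(b (radial x) / (a (radial x) * (a (radial x) + radial x * b (radial x)))) : ℝ) : ℂ)
            * (conj (x q) * x p'))
        * (conj (x i) * ((a₁ (radial x) : ℂ) * (1 : Matrix (Fin n) (Fin n) ℂ) k q
            + (b₁ (radial x) : ℂ) * (conj (x k) * x q))
          + b (radial x) * (conj (x k) * (1 : Matrix (Fin n) (Fin n) ℂ) i q)) := by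
    filter_upwards [eventually_radial_mem hI hp] with x hx
    rw [chernConnection_of_radialHerm hI hg hx (ha _ hx) (hb _ hx),
      radialHerm_inv (by exact_mod_cast ha0 _ hx) rfl (by exact_mod_cast hs0 _ hx)]
    simp only [radialHerm_apply]
    push_cast
    rfl
  refine DifferentiableAt.congr_of_eventuallyEq ?_ hev
  have R : ∀ {F : ℝ → ℝ}, DifferentiableAt ℝ F (radial p) →
      DifferentiableAt ℝ (fun x : Cn n => (F (radial x) : ℂ)) p := fun h =>
    (HasWirtingerAt.comp_radial (i := i) h.hasDerivAt).1
  have Z : ∀ j, DifferentiableAt ℝ (fun x : Cn n => x j) p := fun j =>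
    (HasWirtingerAt.coord p i j).1
  have Zc : ∀ j, DifferentiableAt ℝ (fun x : Cn n => conj (x j)) p := fun j =>
    (HasWirtingerAt.conj_coord p i j).1
  have da := (ha _ hp).differentiableAt
  have db := (hb _ hp).differentiableAt
  have r1 := R (F := fun r => 1 / a r) ((differentiableAt_const _).div da (ha0 _ hp))
  have r2 := R (F := fun r => -(b r / (a r * (a r + r * b r))))
    ((db.div (da.mul (da.add (differentiableAt_id.mul db)))
      (mul_ne_zero (ha0 _ hp) (hs0 _ hp))).neg)
  refine DifferentiableAt.fun_sum fun q _ => ?_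
  exact ((r1.mul_const _).add (r2.mul ((Zc q).mul (Z p')))).mul
    (((Zc i).mul (((R ha₁).mul_const _).add ((R hb₁).mul ((Zc k).mul (Z q))))).add
      ((R db).mul ((Zc k).mul_const _)))

/-- The Chern scalar curvature of `g_{ij̄} = a δᵢⱼ + b z̄ᵢ zⱼ`. Here `ℓ = (log det (g_{ij̄}))'` as a
function of `t`, since `det (g_{ij̄}) = aⁿ⁻¹ (a + t b)`. -/
theorem chernScalarCurvature_of_radialHerm {g : BilinField n} {a b a₁ b₁ ℓ : ℝ → ℝ} {I : Set ℝ}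
    (hI : IsOpen I) (hg : HasRadialHerm g a b I) {p : Cn n} {t ℓ₁ s : ℝ} (ht : radial p = t)
    (hp : t ∈ I)
    (ha : ∀ r ∈ I, HasDerivAt a (a₁ r) r) (hb : ∀ r ∈ I, HasDerivAt b (b₁ r) r)
    (ha₁ : DifferentiableAt ℝ a₁ t) (hb₁ : DifferentiableAt ℝ b₁ t)
    (ha0 : ∀ r ∈ I, a r ≠ 0) (hs0 : ∀ r ∈ I, a r + r * b r ≠ 0) (hs : a t + t * b t = s)
    (hℓ : ∀ r ∈ I, ℓ r = (n - 1) * a₁ r / a r + (a₁ r + b r + r * b₁ r) / (a r + r * b r))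
    (hℓ₁ : HasDerivAt ℓ ℓ₁ t) :
    chernScalarCurvature g p = ((-((n - 1) * ℓ t / a t + (ℓ t + t * ℓ₁) / s) : ℝ) : ℂ) := by
  subst ht
  have hs00 : s ≠ 0 := hs ▸ hs0 _ hp
  have ha0' : (a (radial p) : ℂ) ≠ 0 := by exact_mod_cast ha0 _ hp
  have hs0' : (s : ℂ) ≠ 0 := by exact_mod_cast hs00
  have hs' : (a (radial p) : ℂ) + radial p * b (radial p) = s := by exact_mod_cast hs
  have hinv := radialHerm_mul_inv ha0' hs' hs0' (p := p)
  rw [← radialHerm_inv ha0' hs' hs0', ← hg p hp] at hinv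
  have hric : ∀ i j, chernRicci g i j p = -radialHerm (ℓ (radial p)) ℓ₁ p i j := by
    intro i j
    -- The metric contracts against its inverse: `Θ_{ij̄} = -∑ₖ ∂_{j̄} Γᵏ_{ik}`.
    have h1 : chernRicci g i j p = -∑ k, dzbar j (chernConnection g k i k) p := by
      simp only [chernRicci, chernCurvature, hermInverse]
      rw [← Finset.sum_neg_distrib]
      refine Finset.sum_congr rfl fun k _ => ?_
      simp only [mul_neg, Finset.sum_neg_distrib, Finset.mul_sum]
      rw [Finset.sum_comm]
      have : ∀ p', ∑ l, (hermMatrix g p)⁻¹ l k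
          * (dzbar j (chernConnection g p' i k) p * hermMatrix g p p' l)
          = dzbar j (chernConnection g p' i k) p * (1 : Matrix (Fin n) (Fin n) ℂ) p' k := by
        intro p'
        rw [← hinv, Matrix.mul_apply, Finset.mul_sum]
        refine Finset.sum_congr rfl fun l _ => ?_
        ring
      simp [this, Matrix.one_apply]
    have h2 := HasWirtingerAt.sum (s := Finset.univ) (i := j) (p := p)
      (f := fun k => chernConnection g k i k) fun k _ =>
        ⟨differentiableAt_chernConnection hI hg hp ha hb ha₁ hb₁ ha0 hs0 k i k, rfl, rfl⟩
    have hev : (fun x => ∑ k, chernConnection g k i k x) =ᶠ[nhds p] fun x =>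
        (ℓ (radial x) : ℂ) * conj (x i) := by
      filter_upwards [eventually_radial_mem hI hp] with x hx
      rw [sum_chernConnection_of_radialHerm hI hg hx (ha _ hx) (hb _ hx) (ha0 _ hx) rfl
        (hs0 _ hx), hℓ _ hx]
    have h3 := ((HasWirtingerAt.comp_radial (i := j) hℓ₁).mul
      (HasWirtingerAt.conj_coord p j i)).congr_of_eventuallyEq hev
    rw [h1, ← h2.dzbar_eq, h3.dzbar_eq, radialHerm_apply]
    have : (1 : Matrix (Fin n) (Fin n) ℂ) i j = (1 : Matrix (Fin n) (Fin n) ℂ) j i := by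
      simp only [Matrix.one_apply, eq_comm]
    rw [this]
    ring
  have h4 : chernScalarCurvature g p
      = -((radialHerm (a (radial p)) (b (radial p)) p)⁻¹
        * radialHerm (ℓ (radial p)) ℓ₁ p).trace := by
    simp only [chernScalarCurvature, hermInverse, hric, hg p hp]
    rw [Finset.sum_comm, Matrix.trace, ← Finset.sum_neg_distrib]
    refine Finset.sum_congr rfl fun j _ => ?_
    rw [Matrix.diag, Matrix.mul_apply, ← Finset.sum_neg_distrib]
    refine Finset.sum_congr rfl fun i _ => ?_
    ring
  rw [h4, trace_radialHerm_inv_mul ha0' hs' hs0']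
  push_cast
  ring

end ChernCurvature

/-! ### The equation `S = 2 S_C` and metrics with a radial potential -/

section RadialPotential

open Matrix ComplexConjugate

variable {n : ℕ}

/-- The equation `S = 2 S_C` for a metric conformal, with factor `k(𝐳)`, to the one with potential
`φ(𝐳)`, in terms of `f = φ'` and `l = (log k)'`. -/
theorem scalarCurvature_eq_two_mul_chern_iff (hn : 2 ≤ n) {g : BilinField n}
    {k l f f₁ f₂ : ℝ → ℝ} {I : Set ℝ} (hI : IsOpen I)
    (hgram : HasRadialGram g (fun r => 2 * k r * f r) (fun r => 2 * k r * f₁ r) I)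
    (hherm : HasRadialHerm g (fun r => k r * f r) (fun r => k r * f₁ r) I)
    {p : Cn n} {t l₁ f₃ : ℝ} (ht : radial p = t) (hp : t ∈ I)
    (hk : ∀ r ∈ I, HasDerivAt k (k r * l r) r) (hl : HasDerivAt l l₁ t)
    (hf : ∀ r ∈ I, HasDerivAt f (f₁ r) r) (hf₁ : ∀ r ∈ I, HasDerivAt f₁ (f₂ r) r)
    (hf₂ : HasDerivAt f₂ f₃ t) (hk0 : ∀ r ∈ I, k r ≠ 0) (hf0 : ∀ r ∈ I, f r ≠ 0)
    (hs0 : ∀ r ∈ I, f r + r * f₁ r ≠ 0) :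
    (scalarCurvature g p : ℂ) = 2 * chernScalarCurvature g p ↔
      (n - 1) * l t / f t + (l t + t * l₁ + (n - 1 / 2) * t * l t ^ 2) / (f t + t * f₁ t) = 0 := by
  obtain ⟨s, hs⟩ : ∃ s, f t + t * f₁ t = s := ⟨_, rfl⟩
  have hs00 : s ≠ 0 := hs ▸ hs0 t hp
  have hS := scalarCurvature_of_conformal hI hgram ht hp hk hl hf hf₁ hf₂ hk0 hf0 hs0 hs
  have dS : HasDerivAt (fun r => f r + r * f₁ r) (2 * f₁ t + t * f₂ t) t :=
    ((hf t hp).add ((hasDerivAt_id t).mul (hf₁ t hp))).congr_deriv (by simp; ring)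
  have dS1 : HasDerivAt (fun r => 2 * f₁ r + r * f₂ r) (3 * f₂ t + t * f₃) t :=
    (((hf₁ t hp).const_mul 2).add ((hasDerivAt_id t).mul hf₂)).congr_deriv (by simp; ring)
  have dℓ : HasDerivAt (fun r => n * l r + (n - 1) * (f₁ r / f r)
      + (2 * f₁ r + r * f₂ r) / (f r + r * f₁ r))
      (n * l₁ + (n - 1) * ((f₂ t * f t - f₁ t * f₁ t) / f t ^ 2)
        + ((3 * f₂ t + t * f₃) * s - (2 * f₁ t + t * f₂ t) * (2 * f₁ t + t * f₂ t)) / s ^ 2) t := by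
    have := ((hl.const_mul (n : ℝ)).add
      (((hf₁ t hp).div (hf t hp) (hf0 t hp)).const_mul ((n : ℝ) - 1))).add (dS1.div dS (hs0 t hp))
    rwa [hs] at this
  have ha : ∀ r ∈ I, HasDerivAt (fun r => k r * f r) (k r * (l r * f r + f₁ r)) r := fun r hr =>
    ((hk r hr).mul (hf r hr)).congr_deriv (by ring)
  have hb : ∀ r ∈ I, HasDerivAt (fun r => k r * f₁ r) (k r * (l r * f₁ r + f₂ r)) r := fun r hr =>
    ((hk r hr).mul (hf₁ r hr)).congr_deriv (by ring)
  have hks : ∀ r, k r * f r + r * (k r * f₁ r) = k r * (f r + r * f₁ r) := fun r => by ring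
  have dk := (hk t hp).differentiableAt
  have dl := hl.differentiableAt
  have df := (hf t hp).differentiableAt
  have df₁ := (hf₁ t hp).differentiableAt
  have hC := chernScalarCurvature_of_radialHerm hI hherm ht hp ha hb
    (dk.mul ((dl.mul df).add df₁)) (dk.mul ((dl.mul df₁).add hf₂.differentiableAt))
    (fun r hr => mul_ne_zero (hk0 r hr) (hf0 r hr))
    (fun r hr => by rw [hks]; exact mul_ne_zero (hk0 r hr) (hs0 r hr)) (hks t)
    (fun r hr => by
      have h1 := hk0 r hr
      have h2 := hf0 r hr
      have h3 := hs0 r hr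
      rw [hks]
      obtain ⟨s', hs'⟩ : ∃ s', f r + r * f₁ r = s' := ⟨_, rfl⟩
      have e : k r * (l r * f r + f₁ r) + k r * f₁ r + r * (k r * (l r * f₁ r + f₂ r))
          = k r * (l r * s' + (2 * f₁ r + r * f₂ r)) := by rw [← hs']; ring
      rw [e, hs']
      rw [hs'] at h3
      field_simp
      ring) dℓ
  have hk00 := hk0 t hp
  have hf00 := hf0 t hp
  have hn' : (2 * n - 2 : ℝ) ≠ 0 := by
    have : (2 : ℝ) ≤ n := by exact_mod_cast hn
    intro h; linarith
  have key : scalarCurvature g p - 2 * (-((n - 1) * (n * l t + (n - 1) * (f₁ t / f t)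
      + (2 * f₁ t + t * f₂ t) / (f t + t * f₁ t)) / (k t * f t)
      + (n * l t + (n - 1) * (f₁ t / f t) + (2 * f₁ t + t * f₂ t) / (f t + t * f₁ t)
        + t * (n * l₁ + (n - 1) * ((f₂ t * f t - f₁ t * f₁ t) / f t ^ 2)
        + ((3 * f₂ t + t * f₃) * s - (2 * f₁ t + t * f₂ t) * (2 * f₁ t + t * f₂ t)) / s ^ 2))
        / (k t * (f t + t * f₁ t))))
      = -((2 * n - 2) / k t) * ((n - 1) * l t / f t
        + (l t + t * l₁ + (n - 1 / 2) * t * l t ^ 2) / (f t + t * f₁ t)) := by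
    rw [hS, hs]
    field_simp
    ring
  rw [hC, ← Complex.ofReal_ofNat, ← Complex.ofReal_mul, Complex.ofReal_inj, ← sub_eq_zero, key]
  simp [hn', hk00]

theorem isOpen_radialInterval (α : ℝ) (β : EReal) : IsOpen (radialInterval α β) :=
  (isOpen_lt continuous_const continuous_id).inter
    (isOpen_lt continuous_coe_real_ereal continuous_const)

theorem ordConnected_radialInterval (α : ℝ) (β : EReal) : (radialInterval α β).OrdConnected :=
  ⟨fun _ hx _ hy _ hz =>
    ⟨hx.1.trans_le hz.1, (EReal.coe_le_coe_iff.2 hz.2).trans_lt hy.2⟩⟩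

theorem radialInterval_nonempty {α : ℝ} {β : EReal} (h : (α : EReal) < β) :
    (radialInterval α β).Nonempty := by
  obtain ⟨t, h1, h2⟩ := EReal.lt_iff_exists_real_btwn.1 h
  exact ⟨t, EReal.coe_lt_coe_iff.1 h1, h2⟩

theorem radialInterval_subset {α α' : ℝ} {β β' : EReal} (h : α ≤ α') (h' : β' ≤ β) :
    radialInterval α' β' ⊆ radialInterval α β :=
  fun _ ht => ⟨h.trans_lt ht.1, ht.2.trans_le h'⟩

theorem isOpen_annulus (n : ℕ) (α : ℝ) (β : EReal) : IsOpen (annulus n α β) :=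
  (isOpen_radialInterval α β).preimage continuous_radial

theorem contDiffOn_deriv {F : ℝ → ℝ} {I : Set ℝ} (hI : IsOpen I) (hF : ContDiffOn ℝ ∞ F I) :
    ContDiffOn ℝ ∞ (deriv F) I :=
  ((contDiffOn_infty_iff_deriv_of_isOpen hI).1 hF).2

theorem hasDerivAt_deriv {F : ℝ → ℝ} {I : Set ℝ} (hI : IsOpen I) (hF : ContDiffOn ℝ ∞ F I)
    {t : ℝ} (ht : t ∈ I) : HasDerivAt F (deriv F t) t :=
  ((hF.differentiableOn (by simp)).differentiableAt (hI.mem_nhds ht)).hasDerivAt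

/-- The point `(√t, 0, …, 0)`, which satisfies `𝐳 = t` for `t ≥ 0`. -/
def axisPoint (n : ℕ) [NeZero n] (t : ℝ) : Cn n := EuclideanSpace.single 0 ((Real.sqrt t : ℝ) : ℂ)

theorem radial_axisPoint [NeZero n] {t : ℝ} (ht : 0 ≤ t) : radial (axisPoint n t) = t := by
  rw [radial, Finset.sum_eq_single 0]
  · simp [axisPoint, Real.sq_sqrt ht]
  · intro i _ hi
    simp [axisPoint, hi]
  · simp

theorem hasRadialHerm_of_potential {g : BilinField n} {φ : ℝ → ℝ} {α : ℝ} {β : EReal}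
    (hφ : HasRadialPotential g φ α β) :
    HasRadialHerm g (deriv φ) (deriv (deriv φ)) (radialInterval α β) := by
  intro p hp
  have hI := isOpen_radialInterval α β
  ext i j
  have hev : dzbar j (fun x : Cn n => (φ (radial x) : ℂ)) =ᶠ[nhds p] fun x =>
      ((deriv φ (radial x) : ℝ) : ℂ) * x j := by
    filter_upwards [eventually_radial_mem hI hp] with x hx
    exact (HasWirtingerAt.comp_radial (hasDerivAt_deriv hI hφ.smooth hx)).dzbar_eq
  have h := ((HasWirtingerAt.comp_radial (i := i) (hasDerivAt_deriv hI
    (contDiffOn_deriv hI hφ.smooth) hp)).mul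
    (HasWirtingerAt.coord p i j)).congr_of_eventuallyEq hev
  rw [hφ.potential p hp, h.dz_eq, radialHerm_apply]
  ring

/-- Passing from `g_{ij̄}` to the real frame doubles the coefficients, because
`g(∂/∂xᵢ, ∂/∂xⱼ) = 2 Re g_{ij̄}` and `g(∂/∂xᵢ, ∂/∂yⱼ) = 2 Im g_{ij̄}`. -/
theorem hasRadialGram_of_hermitian {g : BilinField n} {a b : ℝ → ℝ} {α : ℝ} {β : EReal}
    (hg : IsHermitianMetricOn g (annulus n α β))
    (hherm : HasRadialHerm g a b (radialInterval α β)) :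
    HasRadialGram g (fun r => 2 * a r) (fun r => 2 * b r) (radialInterval α β) := by
  intro p hp
  have hJ1 : ∀ i, J₀ n (realFrame (Sum.inl i)) = realFrame (Sum.inr i) := by
    intro i; rw [J₀_apply]; ext j; simp [realFrame]
  have hJ2 : ∀ i, J₀ n (realFrame (Sum.inr i)) = -realFrame (Sum.inl i) := by
    intro i; rw [J₀_apply]; ext j
    by_cases h : j = i <;> simp [realFrame, h]
  have hyy : ∀ i j, g p (realFrame (Sum.inr i)) (realFrame (Sum.inr j))
      = g p (realFrame (Sum.inl i)) (realFrame (Sum.inl j)) := by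
    intro i j; rw [← hJ1, ← hJ1, hg.hermitian p hp]
  have hyx : ∀ i j, g p (realFrame (Sum.inr i)) (realFrame (Sum.inl j))
      = -g p (realFrame (Sum.inl i)) (realFrame (Sum.inr j)) := by
    intro i j
    have := hg.hermitian p hp (realFrame (Sum.inl i)) (realFrame (Sum.inr j))
    rw [hJ1, hJ2, map_neg] at this
    linarith
  -- Compare real and imaginary parts in the definition of `g_{ij̄}`.
  have hh : ∀ i j, _ := fun i j => congrFun (congrFun (hherm p hp) i) j
  simp only [hermMatrix, Matrix.of_apply, hyy, hyx, radialHerm_apply] at hh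
  have hre : ∀ i j, g p (realFrame (Sum.inl i)) (realFrame (Sum.inl j))
      = 2 * (a (radial p) * (1 : Matrix (Fin n) (Fin n) ℝ) i j
        + b (radial p) * ((p i).re * (p j).re + (p i).im * (p j).im)) := by
    intro i j
    have := congrArg Complex.re (hh i j)
    by_cases h : i = j <;> simp [h, Matrix.one_apply] at this ⊢ <;> linarith
  have him : ∀ i j, g p (realFrame (Sum.inl i)) (realFrame (Sum.inr j))
      = 2 * (b (radial p) * ((p i).re * (p j).im - (p i).im * (p j).re)) := by
    intro i j
    have := congrArg Complex.im (hh i j)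
    by_cases h : i = j
    · subst h
      simp at this ⊢
      linarith
    · simp [h] at this ⊢
      linarith
  ext (i | i) (j | j) <;>
    simp only [gramMatrix, Matrix.of_apply, radialGram_apply, realCoord, rotCoord, hyy, hyx, hre,
      him, Matrix.one_apply, Sum.inl.injEq, Sum.inr.injEq, reduceCtorEq, if_false] <;> ring

end RadialPotential

/-! ### Positivity, conformal metrics and the Kähler condition -/

section ConformalRadial

open Matrix

variable {n : ℕ}

/-- A restatement of `ContDiffOn.smul` over an abstract normed space: for spaces of bilinear forms
on `EuclideanSpace` the instance `IsBoundedSMul` is not found. -/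
theorem contDiffOn_smul_of_normed {E F : Type*} [NormedAddCommGroup E] [NormedSpace ℝ E]
    [NormedAddCommGroup F] [NormedSpace ℝ F] {κ : E → ℝ} {g : E → F} {U : Set E}
    (hκ : ContDiffOn ℝ ∞ κ U) (hg : ContDiffOn ℝ ∞ g U) :
    ContDiffOn ℝ ∞ (fun p => κ p • g p) U :=
  hκ.smul hg

theorem differentiableAt_linearMap_comp {E F G : Type*} [NormedAddCommGroup E] [NormedSpace ℝ E]
    [NormedAddCommGroup F] [NormedSpace ℝ F] [FiniteDimensional ℝ F] [NormedAddCommGroup G]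
    [NormedSpace ℝ G] {g : E → F} {U : Set E} (hg : ContDiffOn ℝ ∞ g U) (hU : IsOpen U) {p : E}
    (hp : p ∈ U) (Λ : F →ₗ[ℝ] G) : DifferentiableAt ℝ (fun q => Λ (g q)) p :=
  (LinearMap.toContinuousLinearMap Λ).differentiableAt.comp p
    ((hg.differentiableOn (by simp)).differentiableAt (hU.mem_nhds hp))

/-- Both eigenvalues are positive; `n ≥ 2` is what makes `a` an eigenvalue. -/
theorem radialGram_pos [NeZero n] (hn : 2 ≤ n) {g : BilinField n} {a b : ℝ → ℝ} {α : ℝ} (hα : 0 ≤ α)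
    {β : EReal} (hg : IsHermitianMetricOn g (annulus n α β))
    (hgram : HasRadialGram g a b (radialInterval α β)) {t : ℝ} (ht : t ∈ radialInterval α β) :
    0 < a t ∧ 0 < a t + t * b t := by
  have ht0 : 0 ≤ t := hα.trans ht.1.le
  have hr : radial (axisPoint n t) = t := radial_axisPoint ht0
  have hmem : axisPoint n t ∈ annulus n α β := by rwa [annulus, Set.mem_ofPred_eq, hr]
  have hG := hgram (axisPoint n t) (by rwa [hr])
  rw [hr] at hG
  have hne : ∀ i : Fin n, realFrame (Sum.inl i) ≠ 0 := by
    intro i h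
    have := congrArg (fun q : Cn n => q i) h
    simp [realFrame] at this
  have hval : ∀ i : Fin n, g (axisPoint n t) (realFrame (Sum.inl i)) (realFrame (Sum.inl i)) = _ :=
    fun i => congrFun (congrFun hG (Sum.inl i)) (Sum.inl i)
  simp only [radialGram_apply, realCoord, rotCoord] at hval
  let j : Fin n := ⟨1, hn⟩
  have hj : j ≠ 0 := by
    intro h
    have := congrArg Fin.val h
    simp [j] at this
  have h0 := hg.pos _ hmem _ (hne 0)
  have h1 := hg.pos _ hmem _ (hne j)
  rw [hval] at h0 h1
  simp [axisPoint, hj, Real.mul_self_sqrt ht0] at h0 h1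
  exact ⟨h1, by linarith⟩

theorem isHermitianMetricOn_conformal {g : BilinField n} {κ : Cn n → ℝ} {U : Set (Cn n)}
    (hg : IsHermitianMetricOn g U) (hκ : ContDiffOn ℝ ∞ κ U) (hκ0 : ∀ p ∈ U, 0 < κ p) :
    IsHermitianMetricOn (conformal κ g) U where
  smooth := contDiffOn_smul_of_normed hκ hg.smooth
  symm p hp X Y := by simp [conformal, hg.symm p hp X Y]
  pos p hp X hX := by simpa [conformal] using mul_pos (hκ0 p hp) (hg.pos p hp X hX)
  hermitian p hp X Y := by simp [conformal, hg.hermitian p hp X Y]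

theorem IsHermitianMetricOn.mono {g : BilinField n} {U V : Set (Cn n)}
    (hg : IsHermitianMetricOn g U) (h : V ⊆ U) : IsHermitianMetricOn g V where
  smooth := hg.smooth.mono h
  symm p hp := hg.symm p (h hp)
  pos p hp := hg.pos p (h hp)
  hermitian p hp := hg.hermitian p (h hp)

theorem HasRadialGram.conformal {g : BilinField n} {a b k : ℝ → ℝ} {κ : Cn n → ℝ} {I : Set ℝ}
    (hg : HasRadialGram g a b I) (hκ : ∀ q, radial q ∈ I → κ q = k (radial q)) :
    HasRadialGram (conformal κ g) (fun r => k r * a r) (fun r => k r * b r) I := by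
  intro q hq
  ext i j
  have := congrFun (congrFun (hg q hq) i) j
  simp only [gramMatrix, Matrix.of_apply, radialGram_apply, HermitianKlsc.conformal,
    _root_.smul_apply, smul_eq_mul, hκ q hq] at this ⊢
  rw [this]
  ring

theorem HasRadialHerm.conformal {g : BilinField n} {a b k : ℝ → ℝ} {κ : Cn n → ℝ} {I : Set ℝ}
    (hg : HasRadialHerm g a b I) (hκ : ∀ q, radial q ∈ I → κ q = k (radial q)) :
    HasRadialHerm (conformal κ g) (fun r => k r * a r) (fun r => k r * b r) I := by
  intro q hq
  ext i j
  have := congrFun (congrFun (hg q hq) i) j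
  simp only [radialHerm_apply] at this ⊢
  calc _ = (k (radial q) : ℂ) * hermMatrix g q i j := by
        simp only [hermMatrix, Matrix.of_apply, HermitianKlsc.conformal, _root_.smul_apply,
          smul_eq_mul, hκ q hq]
        push_cast
        ring
    _ = _ := by
        rw [this]
        push_cast
        ring

theorem fundamentalForm_conformal (κ : Cn n → ℝ) (g : BilinField n) :
    fundamentalForm (conformal κ g) = fun p => κ p • fundamentalForm g p := by
  funext p
  ext v
  simp [fundamentalForm_apply, conformal]
  ring

theorem differentiableAt_fundamentalForm {g : BilinField n} {U : Set (Cn n)}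
    (hg : ContDiffOn ℝ ∞ g U) (hU : IsOpen U) {p : Cn n} (hp : p ∈ U) :
    DifferentiableAt ℝ (fundamentalForm g) p := by
  let Λ : (Cn n →L[ℝ] Cn n →L[ℝ] ℝ) →ₗ[ℝ] Cn n [⋀^Fin 2]→L[ℝ] ℝ :=
    { toFun := fun B => fundamentalForm (fun _ => B) 0
      map_add' := fun B C => by
        ext v
        simp [fundamentalForm_apply]
        ring
      map_smul' := fun c B => by
        ext v
        simp [fundamentalForm_apply]
        ring }
  exact differentiableAt_linearMap_comp hg hU hp Λ

/-- `d(κ θ) = κ dθ + dκ ∧ θ` for a `2`-form `θ`. -/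
theorem extDeriv_smul_form_apply {θ : Cn n → Cn n [⋀^Fin 2]→L[ℝ] ℝ} {κ : Cn n → ℝ} {p : Cn n}
    (hθ : DifferentiableAt ℝ θ p) (hκ : DifferentiableAt ℝ κ p) (v : Fin 3 → Cn n) :
    extDeriv (fun q => κ q • θ q) p v = κ p * extDeriv θ p v
      + (fderiv ℝ κ p (v 0) * θ p ![v 1, v 2] - fderiv ℝ κ p (v 1) * θ p ![v 0, v 2]
        + fderiv ℝ κ p (v 2) * θ p ![v 0, v 1]) := by
  have r0 : Fin.removeNth 0 v = ![v 1, v 2] := by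
    ext i; fin_cases i <;> rfl
  have r1 : Fin.removeNth 1 v = ![v 0, v 2] := by
    ext i; fin_cases i <;> rfl
  have r2 : Fin.removeNth 2 v = ![v 0, v 1] := by
    ext i; fin_cases i <;> rfl
  rw [extDeriv, extDeriv, ContinuousAlternatingMap.alternatizeUncurryFin_apply,
    ContinuousAlternatingMap.alternatizeUncurryFin_apply, fderiv_fun_smul hκ hθ]
  simp [Fin.sum_univ_three, r0, r1, r2]
  ring

/-- If `k(𝐳) g` is Kähler along with `g`, then `k` has derivative zero. -/
theorem deriv_eq_zero_of_closed (hn : 2 ≤ n) {g : BilinField n} {a b k : ℝ → ℝ} {κ : Cn n → ℝ}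
    {α : ℝ} (hα : 0 ≤ α) {β : EReal} (hg : IsKahlerMetricOn g (annulus n α β))
    (hgram : HasRadialGram g a b (radialInterval α β))
    (hκ : ∀ q, radial q ∈ radialInterval α β → κ q = k (radial q))
    (hcl : ∀ p ∈ annulus n α β, extDeriv (fundamentalForm (conformal κ g)) p = 0)
    {t k' : ℝ} (ht : t ∈ radialInterval α β) (hk : HasDerivAt k k' t) : k' = 0 := by
  have : NeZero n := ⟨by omega⟩
  have hI := isOpen_radialInterval α β
  have ht0 : 0 < t := hα.trans_lt ht.1
  have hr : radial (axisPoint n t) = t := radial_axisPoint ht0.le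
  obtain ⟨p, hp⟩ : ∃ p, p = axisPoint n t := ⟨_, rfl⟩
  rw [← hp] at hr
  have hmem : p ∈ annulus n α β := by rwa [annulus, Set.mem_ofPred_eq, hr]
  have hpos := (radialGram_pos hn hα hg.isHermitian hgram ht).1
  let j : Fin n := ⟨1, hn⟩
  have hj : j ≠ 0 := by
    intro h
    have := congrArg Fin.val h
    simp [j] at this
  have hκp : ∀ c, HasPartialDerivAt κ (2 * realCoord p c * k') c p := fun c =>
    (HasPartialDerivAt.comp_radial (by rwa [hr])).congr_of_eventuallyEq
      ((eventually_radial_mem hI (by rwa [hr])).mono fun q hq => hκ q hq)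
  -- On `(e₀, e₁, J e₁)` only `dκ(e₀) ω(e₁, J e₁)` survives in `dκ ∧ ω`.
  have h1 := extDeriv_smul_form_apply (differentiableAt_fundamentalForm hg.isHermitian.smooth
    (isOpen_annulus n α β) hmem)
    (hκp (Sum.inl 0)).1 ![realFrame (Sum.inl 0), realFrame (Sum.inl j), realFrame (Sum.inr j)]
  rw [← fundamentalForm_conformal, hcl p hmem, hg.closed p hmem] at h1
  have d0 := (hκp (Sum.inl 0)).2
  have d1 := (hκp (Sum.inl j)).2
  have d2 := (hκp (Sum.inr j)).2
  simp only [partialDeriv] at d0 d1 d2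
  have x0 : realCoord p (Sum.inl 0) = Real.sqrt t := by simp [hp, realCoord, axisPoint]
  have x1 : realCoord p (Sum.inl j) = 0 := by simp [hp, realCoord, axisPoint, hj]
  have x2 : realCoord p (Sum.inr j) = 0 := by simp [hp, realCoord, axisPoint, hj]
  have hθ : fundamentalForm g p ![realFrame (Sum.inl j), realFrame (Sum.inr j)] = a t := by
    have hJ1 : J₀ n (realFrame (Sum.inl j)) = realFrame (Sum.inr j) := by
      rw [J₀_apply]; ext i; simp [realFrame]
    have hG := congrFun (congrFun (hgram p (by rwa [hr])) (Sum.inr j)) (Sum.inr j)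
    rw [hg.isHermitian.fundamentalForm_apply hmem]
    simp only [Matrix.cons_val_zero, Matrix.cons_val_one, hJ1]
    simp only [gramMatrix, Matrix.of_apply, radialGram_apply, x2, hr] at hG
    rw [hG]
    simp [rotCoord, hp, axisPoint, hj]
  simp [d0, d1, d2, x0, x1, x2, hθ] at h1
  rcases h1 with (h1 | h1) | h1
  · exact absurd h1 (Real.sqrt_pos.2 ht0).ne'
  · exact h1
  · exact absurd h1 hpos.ne'

theorem isKahlerMetricOn_conformal_const {g : BilinField n} {κ : Cn n → ℝ} {U : Set (Cn n)}
    (hU : IsOpen U) (hg : IsKahlerMetricOn g U) {c : ℝ} (hc : 0 < c) (hκ : ∀ p ∈ U, κ p = c) :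
    IsKahlerMetricOn (conformal κ g) U where
  isHermitian := isHermitianMetricOn_conformal hg.isHermitian
    (contDiffOn_const.congr hκ) fun p hp => by rwa [hκ p hp]
  closed p hp := by
    have hev : fundamentalForm (conformal κ g) =ᶠ[nhds p] c • fundamentalForm g := by
      filter_upwards [hU.mem_nhds hp] with q hq
      simp only [fundamentalForm_conformal, hκ q hq, Pi.smul_apply]
    rw [hev.extDeriv_eq, extDeriv_smul, hg.closed p hp, smul_zero]

end ConformalRadial

/-! ### Linearization of the equation and sufficiency -/

section HarmonicFactor

variable {n : ℕ}

theorem radialInterval_pos {α : ℝ} (hα : 0 ≤ α) {β : EReal} {t : ℝ} (ht : t ∈ radialInterval α β) :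
    0 < t := hα.trans_lt ht.1

theorem potential_pos (hn : 2 ≤ n) {g : BilinField n} {φ : ℝ → ℝ} {α : ℝ} (hα : 0 ≤ α)
    {β : EReal} (hg : IsKahlerMetricOn g (annulus n α β)) (hφ : HasRadialPotential g φ α β)
    {t : ℝ} (ht : t ∈ radialInterval α β) :
    0 < deriv φ t ∧ 0 < deriv φ t + t * deriv (deriv φ) t := by
  have : NeZero n := ⟨by omega⟩
  have h := radialGram_pos hn hα hg.isHermitian
    (hasRadialGram_of_hermitian hg.isHermitian (hasRadialHerm_of_potential hφ)) ht
  exact ⟨by linarith [h.1], by linarith [h.2]⟩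

theorem exists_radial_eq (hn : 2 ≤ n) {α : ℝ} (hα : 0 ≤ α) {β : EReal} {t : ℝ}
    (ht : t ∈ radialInterval α β) : ∃ p ∈ annulus n α β, radial p = t := by
  have : NeZero n := ⟨by omega⟩
  have hr : radial (axisPoint n t) = t := radial_axisPoint (radialInterval_pos hα ht).le
  exact ⟨axisPoint n t, by rwa [annulus, Set.mem_ofPred_eq, hr], hr⟩

theorem two_mul_sub_one_pos (hn : 2 ≤ n) : (0 : ℝ) < 2 * n - 1 := by
  have : (2 : ℝ) ≤ n := by exact_mod_cast hn
  linarith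

theorem hasDerivAt_conformalFactor (n : ℕ) {u : ℝ → ℝ} {u' t : ℝ} (hu : HasDerivAt u u' t)
    (hu0 : 0 < u t) :
    HasDerivAt (fun r => u r ^ (2 / (2 * (n : ℝ) - 1)))
      (u t ^ (2 / (2 * (n : ℝ) - 1)) * (2 / (2 * (n : ℝ) - 1) * (u' / u t))) t := by
  have h := hu.rpow_const (p := 2 / (2 * (n : ℝ) - 1)) (Or.inl hu0.ne')
  refine h.congr_deriv ?_
  rw [Real.rpow_sub_one hu0.ne']
  have := hu0.ne'
  field_simp

/-- For `κ = u(𝐳) ^ (2 / (2n - 1))`, the metric `κ g` satisfies `S = 2 S_C` iff `u(𝐳)` is harmonic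
for the Kähler metric `g`. -/
theorem scalarCurvature_eq_two_mul_chern_iff_harmonic (hn : 2 ≤ n) {g : BilinField n} {φ : ℝ → ℝ}
    {α : ℝ} (hα : 0 ≤ α) {β : EReal} (hg : IsKahlerMetricOn g (annulus n α β))
    (hφ : HasRadialPotential g φ α β) {u u₁ : ℝ → ℝ}
    (hu : ∀ t ∈ radialInterval α β, HasDerivAt u (u₁ t) t)
    (hu0 : ∀ t ∈ radialInterval α β, 0 < u t) {κ : Cn n → ℝ}
    (hκ : ∀ p, radial p ∈ radialInterval α β → κ p = u (radial p) ^ (2 / (2 * (n : ℝ) - 1)))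
    {p : Cn n} {t u₂ : ℝ} (ht : radial p = t) (htI : t ∈ radialInterval α β)
    (hu₁ : HasDerivAt u₁ u₂ t) :
    (scalarCurvature (conformal κ g) p : ℂ) = 2 * chernScalarCurvature (conformal κ g) p ↔
      (n - 1) * u₁ t / deriv φ t
        + (u₁ t + t * u₂) / (deriv φ t + t * deriv (deriv φ) t) = 0 := by
  have hI := isOpen_radialInterval α β
  have hN := (two_mul_sub_one_pos hn).ne'
  have s1 := contDiffOn_deriv hI hφ.smooth
  have s2 := contDiffOn_deriv hI s1
  have s3 := contDiffOn_deriv hI s2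
  have hherm := hasRadialHerm_of_potential hφ
  have hgram : HasRadialGram (conformal κ g)
      (fun r => 2 * u r ^ (2 / (2 * (n : ℝ) - 1)) * deriv φ r)
      (fun r => 2 * u r ^ (2 / (2 * (n : ℝ) - 1)) * deriv (deriv φ) r) (radialInterval α β) := by
    intro q hq
    rw [(hasRadialGram_of_hermitian hg.isHermitian hherm).conformal
      (k := fun r => u r ^ (2 / (2 * (n : ℝ) - 1))) hκ q hq]
    congr 1 <;> ring
  have hu0t := (hu0 t htI).ne'
  have dl : HasDerivAt (fun r => 2 / (2 * (n : ℝ) - 1) * (u₁ r / u r))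
      (2 / (2 * (n : ℝ) - 1) * ((u₂ * u t - u₁ t * u₁ t) / u t ^ 2)) t :=
    (hu₁.div (hu t htI) hu0t).const_mul _
  rw [scalarCurvature_eq_two_mul_chern_iff hn hI hgram
    (hherm.conformal (k := fun r => u r ^ (2 / (2 * (n : ℝ) - 1))) hκ) ht htI
    (fun r hr => hasDerivAt_conformalFactor n (hu r hr) (hu0 r hr)) dl
    (fun r hr => hasDerivAt_deriv hI s1 hr) (fun r hr => hasDerivAt_deriv hI s2 hr)
    (hasDerivAt_deriv hI s3 htI) (fun r hr => (Real.rpow_pos_of_pos (hu0 r hr) _).ne')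
    (fun r hr => (potential_pos hn hα hg hφ hr).1.ne')
    (fun r hr => (potential_pos hn hα hg hφ hr).2.ne')]
  have h1 := (potential_pos hn hα hg hφ htI).1.ne'
  have h2 := (potential_pos hn hα hg hφ htI).2.ne'
  obtain ⟨s, hs⟩ : ∃ s, deriv φ t + t * deriv (deriv φ) t = s := ⟨_, rfl⟩
  rw [hs] at h2 ⊢
  have e : ∀ x y : ℝ, x = 2 / ((2 * (n : ℝ) - 1) * u t) * y → (x = 0 ↔ y = 0) := by
    intro x y h
    rw [h, mul_eq_zero, or_iff_right]
    exact div_ne_zero two_ne_zero (mul_ne_zero hN hu0t)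
  apply e
  field_simp
  ring

/-- The flux `tⁿ fⁿ⁻¹ u'` has as its derivative a multiple of the Laplacian of `u(𝐳)`. -/
theorem hasDerivAt_flux (hn : 2 ≤ n) {f u₁ : ℝ → ℝ} {f' u₂ t : ℝ}
    (hf : HasDerivAt f f' t) (hf0 : f t ≠ 0) (hs0 : f t + t * f' ≠ 0) (hu : HasDerivAt u₁ u₂ t) :
    HasDerivAt (fun r => r ^ n * f r ^ (n - 1) * u₁ r)
      (t ^ (n - 1) * f t ^ (n - 1) * (f t + t * f')
        * ((n - 1) * u₁ t / f t + (u₁ t + t * u₂) / (f t + t * f'))) t := by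
  obtain ⟨m, rfl⟩ : ∃ m, n = m + 2 := ⟨n - 2, by omega⟩
  refine (((hasDerivAt_pow (m + 2) t).mul (hf.pow (m + 2 - 1))).mul hu).congr_deriv ?_
  obtain ⟨s, hs⟩ : ∃ s, f t + t * f' = s := ⟨_, rfl⟩
  rw [hs] at hs0 ⊢
  simp only [show m + 2 - 1 = m + 1 from rfl, show m + 1 - 1 = m from rfl, Pi.pow_apply,
    Pi.mul_apply]
  push_cast
  field_simp
  rw [← hs]
  ring

theorem contDiff_radial : ContDiff ℝ ∞ (radial : Cn n → ℝ) := by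
  unfold radial
  refine ContDiff.sum fun i _ => ?_
  exact (contDiff_norm_sq ℝ).comp
    ((EuclideanSpace.proj i : Cn n →L[ℂ] ℂ).restrictScalars ℝ).contDiff

/-- Relates the exponent `2 / (2n - 1)` of the linearizing substitution to the odd root in
`factorV`. -/
theorem abs_rpow_sq (hn : 2 ≤ n) {c x : ℝ} (hc : 0 < c) :
    (c ^ ((2 * (n : ℝ) - 1) / 2) * |x|) ^ (2 / (2 * (n : ℝ) - 1))
      = c * (|x| ^ (1 / (2 * (n : ℝ) - 1))) ^ 2 := by
  have hN := (two_mul_sub_one_pos hn).ne'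
  rw [Real.mul_rpow (Real.rpow_nonneg hc.le _) (abs_nonneg x), ← Real.rpow_mul hc.le,
    ← Real.rpow_natCast, ← Real.rpow_mul (abs_nonneg x)]
  congr 1
  · rw [show (2 * (n : ℝ) - 1) / 2 * (2 / (2 * n - 1)) = 1 by field_simp, Real.rpow_one]
  · congr 1
    push_cast
    ring

/-- The sign of a function without zeros on an interval is constant. -/
theorem exists_sign {H : ℝ → ℝ} {J : Set ℝ} (hJ : J.OrdConnected) (hH : ContinuousOn H J)
    (h0 : ∀ t ∈ J, H t ≠ 0) : ∃ σ : ℝ, σ ≠ 0 ∧ ∀ t ∈ J, |H t| = σ * H t := by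
  by_cases h : ∃ t ∈ J, 0 < H t
  · obtain ⟨t, ht, hpos⟩ := h
    refine ⟨1, one_ne_zero, fun r hr => ?_⟩
    rcases (h0 r hr).lt_or_gt with h1 | h1
    · obtain ⟨x, hx, hx0⟩ := hJ.isPreconnected.intermediate_value hr ht hH ⟨h1.le, hpos.le⟩
      exact absurd hx0 (h0 x hx)
    · rw [abs_of_pos h1, one_mul]
  · push Not at h
    refine ⟨-1, by norm_num, fun r hr => ?_⟩
    rw [abs_of_nonpos (h r hr), neg_one_mul]

theorem contDiffOn_antiderivative {φ H : ℝ → ℝ} {α : ℝ} (hα : 0 ≤ α)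
    {β : EReal} (hφ : ContDiffOn ℝ ∞ φ (radialInterval α β))
    (hφ0 : ∀ t ∈ radialInterval α β, 0 < deriv φ t) (hH : IsAntiderivative n φ α β H) :
    ContDiffOn ℝ ∞ (fun t => 1 / (t ^ n * deriv φ t ^ (n - 1))) (radialInterval α β) ∧
      ContDiffOn ℝ ∞ H (radialInterval α β) := by
  have hI := isOpen_radialInterval α β
  have h1 : ContDiffOn ℝ ∞ (fun t => 1 / (t ^ n * deriv φ t ^ (n - 1))) (radialInterval α β) :=
    contDiffOn_const.div ((contDiffOn_id.pow n).mul ((contDiffOn_deriv hI hφ).pow (n - 1)))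
      fun t ht => mul_ne_zero (pow_ne_zero _ (radialInterval_pos hα ht).ne')
        (pow_ne_zero _ (hφ0 t ht).ne')
  refine ⟨h1, (contDiffOn_infty_iff_deriv_of_isOpen hI).2
    ⟨fun t ht => (hH t ht).differentiableAt.differentiableWithinAt, h1.congr fun t ht =>
      (hH t ht).deriv⟩⟩

/-- Sufficiency: `c v²` is a conformal factor with the required property wherever `H` has
no zero. -/
theorem isNonKahlerKlscOn_of_antiderivative (hn : 2 ≤ n) {g : BilinField n} {φ : ℝ → ℝ}
    {α : ℝ} (hα : 0 ≤ α) {β : EReal} (hαβ : (α : EReal) < β)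
    (hg : IsKahlerMetricOn g (annulus n α β))
    (hφ : HasRadialPotential g φ α β) {H : ℝ → ℝ} (hH : IsAntiderivative n φ α β H)
    (hH0 : ∀ t ∈ radialInterval α β, H t ≠ 0) {c : ℝ} (hc : 0 < c) {κ : Cn n → ℝ}
    (hκ : ∀ p ∈ annulus n α β, κ p = c * factorV n H p ^ 2) :
    IsNonKahlerKlscOn (conformal κ g) (annulus n α β) := by
  have hI := isOpen_radialInterval α β
  have hpos := fun t ht => potential_pos hn hα hg hφ (t := t) ht
  obtain ⟨sH', sH⟩ := contDiffOn_antiderivative hα hφ.smooth (fun t ht => (hpos t ht).1) hH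
  obtain ⟨σ, hσ0, hσ⟩ := exists_sign (ordConnected_radialInterval α β) sH.continuousOn hH0
  -- `u = C |H|` with `C` chosen such that `u ^ (2 / (2n - 1)) = c v²`.
  obtain ⟨C, hC⟩ : ∃ C, C = c ^ ((2 * (n : ℝ) - 1) / 2) := ⟨_, rfl⟩
  have hC0 : 0 < C := hC ▸ Real.rpow_pos_of_pos hc _
  obtain ⟨u, hu⟩ : ∃ u : ℝ → ℝ, u = fun t => C * σ * H t := ⟨_, rfl⟩
  have huabs : ∀ t ∈ radialInterval α β, u t = C * |H t| := fun t ht => by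
    simp only [hu, hσ t ht, mul_assoc]
  have hu0 : ∀ t ∈ radialInterval α β, 0 < u t := fun t ht => by
    rw [huabs t ht]
    exact mul_pos hC0 (abs_pos.2 (hH0 t ht))
  obtain ⟨u₁, hu₁⟩ : ∃ u₁ : ℝ → ℝ, u₁ = fun t => C * σ * (1 / (t ^ n * deriv φ t ^ (n - 1))) :=
    ⟨_, rfl⟩
  have du : ∀ t ∈ radialInterval α β, HasDerivAt u (u₁ t) t := fun t ht => by
    rw [hu, hu₁]
    exact (hH t ht).const_mul (C * σ)
  have du₁ : ∀ t ∈ radialInterval α β, HasDerivAt u₁ (deriv u₁ t) t := fun t ht => by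
    have : ContDiffOn ℝ ∞ u₁ (radialInterval α β) := hu₁ ▸ contDiffOn_const.mul sH'
    exact hasDerivAt_deriv hI this ht
  have hκu : ∀ p, radial p ∈ radialInterval α β →
      κ p = u (radial p) ^ (2 / (2 * (n : ℝ) - 1)) := fun p hp => by
    rw [hκ p hp, huabs _ hp, hC, abs_rpow_sq hn hc, factorV]
  have sκ : ContDiffOn ℝ ∞ κ (annulus n α β) := by
    have h1 : ContDiffOn ℝ ∞ (fun t => u t ^ (2 / (2 * (n : ℝ) - 1))) (radialInterval α β) :=
      ContDiffOn.rpow_const_of_ne (hu ▸ contDiffOn_const.mul sH) fun t ht => (hu0 t ht).ne'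
    exact (h1.comp contDiff_radial.contDiffOn fun p hp => hp).congr hκu
  have hκ0 : ∀ p ∈ annulus n α β, 0 < κ p := fun p hp => by
    rw [hκu p hp]
    exact Real.rpow_pos_of_pos (hu0 _ hp) _
  refine ⟨isHermitianMetricOn_conformal hg.isHermitian sκ hκ0, fun hK => ?_, fun p hp => ?_⟩
  · obtain ⟨t, ht⟩ := radialInterval_nonempty hαβ
    have h := deriv_eq_zero_of_closed hn hα hg (hasRadialGram_of_hermitian hg.isHermitian
      (hasRadialHerm_of_potential hφ)) (k := fun r => u r ^ (2 / (2 * (n : ℝ) - 1))) hκu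
      hK.closed ht (hasDerivAt_conformalFactor n (du t ht) (hu0 t ht))
    refine absurd h (mul_ne_zero (Real.rpow_pos_of_pos (hu0 t ht) _).ne'
      (mul_ne_zero (div_ne_zero two_ne_zero (two_mul_sub_one_pos hn).ne')
        (div_ne_zero ?_ (hu0 t ht).ne')))
    rw [hu₁]
    exact mul_ne_zero (mul_ne_zero hC0.ne' hσ0) (one_div_ne_zero (mul_ne_zero
      (pow_ne_zero _ (radialInterval_pos hα ht).ne') (pow_ne_zero _ (hpos t ht).1.ne')))
  · have hp' : radial p ∈ radialInterval α β := hp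
    rw [scalarCurvature_eq_two_mul_chern_iff_harmonic hn hα hg hφ du hu0 hκu rfl hp'
      (du₁ _ hp')]
    have t0 := (radialInterval_pos hα hp').ne'
    have f0 := (hpos _ hp').1.ne'
    have s0 := (hpos _ hp').2.ne'
    have hW := hasDerivAt_flux hn (hasDerivAt_deriv hI (contDiffOn_deriv hI hφ.smooth) hp') f0
      s0 (du₁ _ hp')
    have hev : (fun r => r ^ n * deriv φ r ^ (n - 1) * u₁ r) =ᶠ[nhds (radial p)]
        fun _ => C * σ := by
      filter_upwards [hI.mem_nhds hp'] with r hr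
      have h1 := (radialInterval_pos hα hr).ne'
      have h2 := (hpos r hr).1.ne'
      rw [hu₁]
      field_simp
    have h0 := hW.unique ((hasDerivAt_const _ (C * σ)).congr_of_eventuallyEq hev)
    exact (mul_eq_zero.1 h0).resolve_left
      (mul_ne_zero (mul_ne_zero (pow_ne_zero _ t0) (pow_ne_zero _ f0)) s0)

end HarmonicFactor

/-! ### The functions `H` -/

section Antiderivative

variable {n : ℕ}

theorem one_div_pow_mul_pos {φ : ℝ → ℝ} {t : ℝ} (ht : 0 < t) (h : 0 < deriv φ t) :
    0 < 1 / (t ^ n * deriv φ t ^ (n - 1)) := by positivity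

theorem IsAntiderivative.strictMonoOn {φ H : ℝ → ℝ} {α : ℝ} (hα : 0 ≤ α) {β : EReal}
    (hφ0 : ∀ t ∈ radialInterval α β, 0 < deriv φ t) (hH : IsAntiderivative n φ α β H) :
    StrictMonoOn H (radialInterval α β) := by
  refine strictMonoOn_of_deriv_pos (ordConnected_radialInterval α β).convex
    (fun t ht => (hH t ht).continuousAt.continuousWithinAt) fun t ht => ?_
  have ht' := interior_subset ht
  rw [(hH t ht').deriv]
  exact one_div_pow_mul_pos (radialInterval_pos hα ht') (hφ0 t ht')

theorem exists_isAntiderivative (n : ℕ) {φ : ℝ → ℝ} {α : ℝ} (hα : 0 ≤ α) {β : EReal}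
    (hφ : ContDiffOn ℝ ∞ φ (radialInterval α β))
    (hφ0 : ∀ t ∈ radialInterval α β, 0 < deriv φ t) :
    ∃ H : ℝ → ℝ, IsAntiderivative n φ α β H := by
  have hI := isOpen_radialInterval α β
  rcases (radialInterval α β).eq_empty_or_nonempty with h | ⟨c, hc⟩
  · exact ⟨0, fun t ht => by simp [h] at ht⟩
  have hcont : ContinuousOn (fun t => 1 / (t ^ n * deriv φ t ^ (n - 1))) (radialInterval α β) :=
    continuousOn_const.div ((continuousOn_id.pow n).mul
      ((contDiffOn_deriv hI hφ).continuousOn.pow (n - 1)))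
      fun t ht => mul_ne_zero (pow_ne_zero _ (radialInterval_pos hα ht).ne')
        (pow_ne_zero _ (hφ0 t ht).ne')
  refine ⟨fun t => ∫ r in c..t, 1 / (r ^ n * deriv φ r ^ (n - 1)), fun t ht => ?_⟩
  exact intervalIntegral.integral_hasDerivAt_right
    ((hcont.mono ((ordConnected_radialInterval α β).uIcc_subset hc ht)).intervalIntegrable)
    (hcont.stronglyMeasurableAtFilter hI t ht) (hcont.continuousAt (hI.mem_nhds ht))

/-- `H' = 1 / (t (t φ')ⁿ⁻¹)` is decreasing, because `t φ'` is positive and increasing. -/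
theorem IsAntiderivative.concaveOn (hn : 2 ≤ n) {φ H : ℝ → ℝ} {α : ℝ} (hα : 0 ≤ α) {β : EReal}
    (hφ : ContDiffOn ℝ ∞ φ (radialInterval α β))
    (hφ0 : ∀ t ∈ radialInterval α β, 0 < deriv φ t)
    (hφ1 : ∀ t ∈ radialInterval α β, 0 < deriv φ t + t * deriv (deriv φ) t)
    (hH : IsAntiderivative n φ α β H) : ConcaveOn ℝ (radialInterval α β) H := by
  have hI := isOpen_radialInterval α β
  have hconv : Convex ℝ (radialInterval α β) := (ordConnected_radialInterval α β).convex
  have hmono : MonotoneOn (fun t => t * deriv φ t) (radialInterval α β) := by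
    have hd : ∀ t ∈ radialInterval α β, HasDerivAt (fun t => t * deriv φ t)
        (deriv φ t + t * deriv (deriv φ) t) t := fun t ht =>
      ((hasDerivAt_id t).mul (hasDerivAt_deriv hI (contDiffOn_deriv hI hφ) ht)).congr_deriv
        (by simp)
    refine monotoneOn_of_deriv_nonneg hconv
      (fun t ht => (hd t ht).continuousAt.continuousWithinAt)
      (fun t ht => (hd t (interior_subset ht)).differentiableAt.differentiableWithinAt)
      fun t ht => ?_
    rw [(hd t (interior_subset ht)).deriv]
    exact (hφ1 t (interior_subset ht)).le
  refine AntitoneOn.concaveOn_of_deriv hconv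
    (fun t ht => (hH t ht).continuousAt.continuousWithinAt)
    (fun t ht => (hH t (interior_subset ht)).differentiableAt.differentiableWithinAt)
    fun t ht r hr htr => ?_
  have ht' := interior_subset ht
  have hr' := interior_subset hr
  have t0 := radialInterval_pos hα ht'
  have r0 := radialInterval_pos hα hr'
  rw [(hH t ht').deriv, (hH r hr').deriv]
  have e : ∀ x : ℝ, x ^ n * deriv φ x ^ (n - 1) = x * (x * deriv φ x) ^ (n - 1) := by
    intro x
    obtain ⟨m, rfl⟩ : ∃ m, n = m + 1 := ⟨n - 1, by omega⟩
    simp only [Nat.add_sub_cancel]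
    ring
  rw [e, e]
  have p1 := mul_pos t0 (hφ0 t ht')
  have p2 := mul_pos r0 (hφ0 r hr')
  have := hmono ht' hr' htr
  simp only at this
  gcongr

theorem IsAntiderivative.exists_bound (hn : 2 ≤ n) {φ H : ℝ → ℝ} {α : ℝ} (hα : 0 ≤ α)
    {β : EReal} (hβ : β ≠ ⊤) (hφ : ContDiffOn ℝ ∞ φ (radialInterval α β))
    (hφ0 : ∀ t ∈ radialInterval α β, 0 < deriv φ t)
    (hφ1 : ∀ t ∈ radialInterval α β, 0 < deriv φ t + t * deriv (deriv φ) t)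
    (hH : IsAntiderivative n φ α β H) : ∃ M, ∀ t ∈ radialInterval α β, H t < M := by
  rcases (radialInterval α β).eq_empty_or_nonempty with h | ⟨c, hc⟩
  · exact ⟨0, fun t ht => by simp [h] at ht⟩
  have hb : β ≠ ⊥ := (hc.2.trans_le' bot_le).ne'
  lift β to ℝ using ⟨hβ, hb⟩
  have hlt : ∀ t ∈ radialInterval α (β : EReal), t < β := fun t ht => EReal.coe_lt_coe_iff.1 ht.2
  have hpos := one_div_pow_mul_pos (n := n) (radialInterval_pos hα hc) (hφ0 c hc)
  refine ⟨H c + 1 / (c ^ n * deriv φ c ^ (n - 1)) * (β - c), fun t ht => ?_⟩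
  have hbc := mul_pos hpos (sub_pos.2 (hlt c hc))
  rcases le_or_gt t c with h | h
  · have := (hH.strictMonoOn hα hφ0).monotoneOn ht hc h
    linarith
  · have := (hH.concaveOn hn hα hφ hφ0 hφ1).slope_le_of_hasDerivAt hc ht h (hH c hc)
    rw [slope_def_field, div_le_iff₀ (sub_pos.2 h)] at this
    have h2 := mul_lt_mul_of_pos_left (sub_lt_sub_right (hlt t ht) c) hpos
    linarith

theorem exists_isAntiderivative_ne_zero (hn : 2 ≤ n) {φ : ℝ → ℝ} {α : ℝ} (hα : 0 ≤ α)
    {β : EReal} (hβ : β ≠ ⊤) (hφ : ContDiffOn ℝ ∞ φ (radialInterval α β))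
    (hφ0 : ∀ t ∈ radialInterval α β, 0 < deriv φ t)
    (hφ1 : ∀ t ∈ radialInterval α β, 0 < deriv φ t + t * deriv (deriv φ) t) :
    ∃ H : ℝ → ℝ, IsAntiderivative n φ α β H ∧ ∀ t ∈ radialInterval α β, H t ≠ 0 := by
  obtain ⟨H, hH⟩ := exists_isAntiderivative n hα hφ hφ0
  obtain ⟨M, hM⟩ := hH.exists_bound hn hα hβ hφ hφ0 hφ1
  exact ⟨fun t => H t - M, fun t ht => (hH t ht).sub_const M, fun t ht =>
    (sub_neg.2 (hM t ht)).ne⟩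

end Antiderivative

/-! ### Uniqueness of the conformal factor -/

section Uniqueness

variable {n : ℕ}

/-- A `U(n)`-invariant function is a function of `𝐳`: complete `p / ‖p‖` to an orthonormal basis;
taking coordinates in this basis is a unitary map that carries `p` to the first axis. -/
theorem eq_axisPoint_of_invariant [NeZero n] {κ : Cn n → ℝ} {U : Set (Cn n)}
    (hκ : ∀ A : Cn n ≃ₗᵢ[ℂ] Cn n, ∀ p ∈ U, κ (A p) = κ p) {p : Cn n} (hp : p ∈ U) (hp0 : p ≠ 0) :
    κ p = κ (axisPoint n (radial p)) := by
  have hnorm : ‖p‖ ≠ 0 := norm_ne_zero_iff.2 hp0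
  obtain ⟨b, hb⟩ := Orthonormal.exists_orthonormalBasis_extension_of_card_eq (𝕜 := ℂ)
    (E := Cn n) (ι := Fin n) (by simp) (v := fun _ => ((‖p‖ : ℂ)⁻¹ • p)) (s := {0}) (by
      refine ⟨fun i => ?_, fun i j hij => absurd (Subsingleton.elim i j) hij⟩
      simp [Set.domRestrict, norm_smul, hnorm])
  have hp' : p = (‖p‖ : ℂ) • b 0 := by
    rw [hb 0 rfl, smul_smul, mul_inv_cancel₀ (by exact_mod_cast hnorm), one_smul]
  have hr : Real.sqrt (radial p) = ‖p‖ := by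
    rw [radial, ← EuclideanSpace.norm_sq_eq, Real.sqrt_sq (norm_nonneg p)]
  have : b.repr p = axisPoint n (radial p) := by
    conv_lhs => rw [hp']
    rw [map_smul, b.repr_self, axisPoint, hr]
    ext i
    by_cases h : i = 0 <;> simp [h]
  rw [← this, hκ b.repr p hp]

theorem contDiffOn_axisPoint [NeZero n] {s : Set ℝ} (hs : ∀ t ∈ s, 0 < t) :
    ContDiffOn ℝ ∞ (axisPoint n) s := by
  have h1 : ContDiffOn ℝ ∞ Real.sqrt s := fun t ht =>
    (Real.contDiffAt_sqrt (hs t ht).ne').contDiffWithinAt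
  have h2 : axisPoint n = fun t => Real.sqrt t • (EuclideanSpace.single 0 1 : Cn n) := by
    funext t
    ext i
    by_cases h : i = 0 <;> simp [axisPoint, h]
  rw [h2]
  exact h1.smul contDiffOn_const

/-- Necessity: every invariant conformal factor with the required property is `c v²` for
some `H`. -/
theorem exists_antiderivative_of_isNonKahlerKlscOn (hn : 2 ≤ n) {g : BilinField n} {φ : ℝ → ℝ}
    {α : ℝ} (hα : 0 ≤ α) {β : EReal} (hαβ : (α : EReal) < β)
    (hg : IsKahlerMetricOn g (annulus n α β))
    (hφ : HasRadialPotential g φ α β) {κ : Cn n → ℝ}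
    (hκ : IsUnitaryInvariantFactorOn κ (annulus n α β))
    (hK : IsNonKahlerKlscOn (conformal κ g) (annulus n α β)) :
    ∃ (H : ℝ → ℝ) (c : ℝ), IsAntiderivative n φ α β H ∧ (∀ t ∈ radialInterval α β, H t ≠ 0) ∧
      0 < c ∧ ∀ p ∈ annulus n α β, κ p = c * factorV n H p ^ 2 := by
  have : NeZero n := ⟨by omega⟩
  have hI := isOpen_radialInterval α β
  have hpre := (ordConnected_radialInterval α β).isPreconnected
  have hN := (two_mul_sub_one_pos hn).ne'
  have hpos := fun t ht => potential_pos hn hα hg hφ (t := t) ht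
  have haxis : ∀ t ∈ radialInterval α β, axisPoint n t ∈ annulus n α β := fun t ht => by
    rwa [annulus, Set.mem_ofPred_eq, radial_axisPoint (radialInterval_pos hα ht).le]
  have sk : ContDiffOn ℝ ∞ (fun t => κ (axisPoint n t)) (radialInterval α β) :=
    hκ.smooth.comp (contDiffOn_axisPoint fun t ht => radialInterval_pos hα ht) haxis
  -- The linearizing variable: `κ = u(𝐳) ^ (2 / (2n - 1))`.
  obtain ⟨u, hu⟩ : ∃ u : ℝ → ℝ, u = fun t => κ (axisPoint n t) ^ ((2 * (n : ℝ) - 1) / 2) :=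
    ⟨_, rfl⟩
  have hu0 : ∀ t ∈ radialInterval α β, 0 < u t := fun t ht => by
    rw [hu]
    exact Real.rpow_pos_of_pos (hκ.pos _ (haxis t ht)) _
  have su : ContDiffOn ℝ ∞ u (radialInterval α β) := hu ▸
    ContDiffOn.rpow_const_of_ne sk fun t ht => (hκ.pos _ (haxis t ht)).ne'
  have hκu : ∀ p, radial p ∈ radialInterval α β →
      κ p = u (radial p) ^ (2 / (2 * (n : ℝ) - 1)) := fun p hp => by
    have hp0 : p ≠ 0 := by
      rintro rfl
      have := radialInterval_pos hα hp
      simp [radial] at this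
    rw [eq_axisPoint_of_invariant hκ.invariant hp hp0, hu, ← Real.rpow_mul
      (hκ.pos _ (haxis _ hp)).le,
      show (2 * (n : ℝ) - 1) / 2 * (2 / (2 * n - 1)) = 1 by field_simp, Real.rpow_one]
  have du : ∀ t ∈ radialInterval α β, HasDerivAt u (deriv u t) t := fun t ht =>
    hasDerivAt_deriv hI su ht
  have dW : ∀ t ∈ radialInterval α β,
      HasDerivAt (fun r => r ^ n * deriv φ r ^ (n - 1) * deriv u r) 0 t := fun t ht => by
    obtain ⟨p, hp, hpt⟩ := exists_radial_eq hn hα ht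
    have du₁ := hasDerivAt_deriv hI (contDiffOn_deriv hI su) ht
    refine (hasDerivAt_flux hn (hasDerivAt_deriv hI (contDiffOn_deriv hI hφ.smooth) ht)
      (hpos t ht).1.ne' (hpos t ht).2.ne' du₁).congr_deriv ?_
    rw [(scalarCurvature_eq_two_mul_chern_iff_harmonic hn hα hg hφ du hu0 hκu hpt ht du₁).1
      (hK.scalar_eq p hp), mul_zero]
  obtain ⟨C, hC⟩ := hI.exists_is_const_of_deriv_eq_zero hpre
    (fun t ht => (dW t ht).differentiableAt.differentiableWithinAt) fun t ht => (dW t ht).deriv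
  have hu' : ∀ t ∈ radialInterval α β,
      deriv u t = C * (1 / (t ^ n * deriv φ t ^ (n - 1))) := fun t ht => by
    have h1 := pow_ne_zero n (radialInterval_pos hα ht).ne'
    have h2 := pow_ne_zero (n - 1) (hpos t ht).1.ne'
    rw [← hC t ht]
    field_simp
  -- If the flux vanished, `κ` would be constant and `κ g` Kähler.
  have hC0 : C ≠ 0 := by
    rintro rfl
    obtain ⟨c, hc⟩ := hI.exists_is_const_of_deriv_eq_zero hpre
      (fun t ht => (du t ht).differentiableAt.differentiableWithinAt)
      fun t ht => by rw [hu' t ht, zero_mul, Pi.zero_apply]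
    obtain ⟨t, ht⟩ := radialInterval_nonempty hαβ
    refine hK.not_kahler (isKahlerMetricOn_conformal_const (isOpen_annulus n α β) hg
      (c := c ^ (2 / (2 * (n : ℝ) - 1))) (Real.rpow_pos_of_pos (hc t ht ▸ hu0 t ht) _)
      fun p hp => ?_)
    rw [hκu p hp, hc _ hp]
  refine ⟨fun t => u t / C, |C| ^ (2 / (2 * (n : ℝ) - 1)), fun t ht => ?_, fun t ht =>
    div_ne_zero (hu0 t ht).ne' hC0, Real.rpow_pos_of_pos (abs_pos.2 hC0) _, fun p hp => ?_⟩
  · refine ((du t ht).div_const C).congr_deriv ?_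
    rw [hu' t ht]
    field_simp
  · have hc := Real.rpow_pos_of_pos (abs_pos.2 hC0) (2 / (2 * (n : ℝ) - 1))
    rw [hκu p hp, factorV, ← abs_rpow_sq hn hc, ← Real.rpow_mul (abs_nonneg C),
      show (2 / (2 * (n : ℝ) - 1)) * ((2 * n - 1) / 2) = 1 by field_simp, Real.rpow_one,
      ← abs_mul, mul_div_cancel₀ _ hC0, abs_of_pos (hu0 _ hp)]

end Uniqueness

end HermitianKlsc

end

theorem theorem1 (n : ℕ) (hn : 2 ≤ n) (α : ℝ) (hα : 0 ≤ α) (β : EReal) (hαβ : (α : EReal) < β)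
    (g : HermitianKlsc.BilinField n) (φ : ℝ → ℝ)
    (hg : HermitianKlsc.IsKahlerMetricOn g (HermitianKlsc.annulus n α β))
    (hφ : HermitianKlsc.HasRadialPotential g φ α β) :
    -- the indefinite integral makes sense, and any choice of it vanishes at most once
    (∃ H : ℝ → ℝ, HermitianKlsc.IsAntiderivative n φ α β H) ∧
    (∀ H : ℝ → ℝ, HermitianKlsc.IsAntiderivative n φ α β H →
      {t ∈ HermitianKlsc.radialInterval α β | H t = 0}.Subsingleton) ∧
    -- if the outer radius is finite, the constant can be chosen so that it vanishes nowhere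
    (β ≠ ⊤ → ∃ H : ℝ → ℝ, HermitianKlsc.IsAntiderivative n φ α β H ∧
      ∀ t ∈ HermitianKlsc.radialInterval α β, H t ≠ 0) ∧
    -- `v² g` is non-Kähler Hermitian with `S = 2 S_C` on each (sub-)annulus without zeros of `v`
    (∀ H : ℝ → ℝ, HermitianKlsc.IsAntiderivative n φ α β H →
      ∀ (α' : ℝ) (β' : EReal), α ≤ α' → β' ≤ β → (α' : EReal) < β' →
        (∀ t ∈ HermitianKlsc.radialInterval α' β', H t ≠ 0) →
        HermitianKlsc.IsNonKahlerKlscOn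
          (HermitianKlsc.conformal (fun p => HermitianKlsc.factorV n H p ^ 2) g)
          (HermitianKlsc.annulus n α' β')) ∧
    -- up to scale and the constant of integration, these are all the `U(n)`-invariant factors
    (∀ κ : HermitianKlsc.Cn n → ℝ,
      HermitianKlsc.IsUnitaryInvariantFactorOn κ (HermitianKlsc.annulus n α β) →
      (HermitianKlsc.IsNonKahlerKlscOn (HermitianKlsc.conformal κ g)
          (HermitianKlsc.annulus n α β) ↔
        ∃ (H : ℝ → ℝ) (c : ℝ), HermitianKlsc.IsAntiderivative n φ α β H ∧
          (∀ t ∈ HermitianKlsc.radialInterval α β, H t ≠ 0) ∧ 0 < c ∧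
          ∀ p ∈ HermitianKlsc.annulus n α β,
            κ p = c * HermitianKlsc.factorV n H p ^ 2)) := by
  have hpos := fun t ht => HermitianKlsc.potential_pos hn hα hg hφ (t := t) ht
  have hf0 := fun t ht => (hpos t ht).1
  refine ⟨HermitianKlsc.exists_isAntiderivative n hα hφ.smooth hf0, fun H hH => ?_, fun hβ =>
    HermitianKlsc.exists_isAntiderivative_ne_zero hn hα hβ hφ.smooth hf0 fun t ht => (hpos t ht).2,
    fun H hH α' β' hα' hβ' hlt hH0 => ?_, fun κ hκ => ⟨fun hK =>
      HermitianKlsc.exists_antiderivative_of_isNonKahlerKlscOn hn hα hαβ hg hφ hκ hK, ?_⟩⟩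
  · rintro t ⟨ht, ht0⟩ r ⟨hr, hr0⟩
    exact (hH.strictMonoOn hα hf0).injOn ht hr (ht0.trans hr0.symm)
  · have hsub := HermitianKlsc.radialInterval_subset hα' hβ'
    have hsub' : HermitianKlsc.annulus n α' β' ⊆ HermitianKlsc.annulus n α β :=
      fun p hp => hsub hp
    refine HermitianKlsc.isNonKahlerKlscOn_of_antiderivative hn (hα.trans hα') hlt
      ⟨hg.isHermitian.mono hsub', fun p hp => hg.closed p (hsub' hp)⟩
      ⟨hφ.smooth.mono hsub, fun p hp => hφ.potential p (hsub' hp)⟩ (fun t ht => hH t (hsub ht))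
      hH0 one_pos fun p _ => (one_mul _).symm
  · rintro ⟨H, c, hH, hH0, hc, h⟩
    exact HermitianKlsc.isNonKahlerKlscOn_of_antiderivative hn hα hαβ hg hφ hH hH0 hc h
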